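/- Let $t=(t^{(1)},t^{(2)},t^{(3)})$ with $t^{(i)}=(t^{(i)}_1,t^{(i)}_2,\dots)$, $\xi(t^{(i)},z)=\sum_{k\ge1}t^{(i)}_kz^k$, $[z]=(z,z^2/2,z^3/3,\dots)$, and let $t\mp[z]_i$ denote $t$ with $t^{(i)}$ replaced by $t^{(i)}\mp[z]$. For $\bm m=(m_1,m_2)\in\mathbb Z^2$ put $\bm e_1=(1,0)$, $\bm e_2=(0,1)$, $\bm e=(1,1)$. Let $\tau_{\bm m}\in\mathbb C[[t]]$ ($\bm m\in\mathbb Z^2$) be nonzero formal power series that satisfy the three-component KP bilinear equation: for all $\bm m,\bm m'\in\mathbb Z^2$ and independent times $t,t'$, $$\oint_{C_R}\frac{dz}{2\pi i}z^{m_1-m_1'}e^{\xi(t^{(1)}-t'^{(1)},z)}\tau_{\bm m}(t-[z^{-1}]_1)\tau_{\bm m'}(t'+[z^{-1}]_1)$$ $$=\oint_{C_r}\frac{dz}{2\pi i}z^{m_2-m_2'}e^{\xi(t^{(2)}-t'^{(2)},z^{-1})}\tau_{\bm m+\bm e}(t-[z]_2)\tau_{\bm m'-\bm e}(t'+[z]_2)$$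 $$\quad+\oint_{C_r}\frac{dz}{2\pi i}(-1)^{m_2+m_2'}z^{m_1-m_2-m_1'+m_2'}e^{\xi(t^{(3)}-t'^{(3)},z^{-1})}\tau_{\bm m+\bm e_1}(t-[z]_3)\tau_{\bm m'-\bm e_1}(t'+[z]_3),$$ where each contour integral means the coefficient of $z^{-1}$ of the formal expansion. Let $\Lambda_1,\Lambda_2$ be the shifts $\Lambda_i(f(\bm m))=f(\bm m+\bm e_i)$, $\Delta_2=\Lambda_2-1$, $\Delta_2^*=\Lambda_2^{-1}-1$, $\Delta_2^{-1}=\sum_{j\ge1}\Lambda_2^{-j}$, $(\Delta_2^*)^{-1}=\sum_{j\ge1}\Lambda_2^{j}$. Formal operators are $A=\sum a_{j_1,j_2}(\bm m)\Lambda_1^{j_1}\Lambda_2^{j_2}$ with coefficients in the fraction field of $\mathbb C[[t]]$. $A_{i,P}$ is the sum of the terms of $A$ whose order $j_i$ in $\Lambda_i$ satisfies $P$ ($P=[0]$ means order $0$); $A_{\Delta_2,\ge1}$ (resp. $A_{\Delta_2^*,\ge1}$) is the part of positive order in $\Delta_2$ (resp. $\Delta_2^*$) after rewriting $A$ in powers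 of $\Delta_2$ (resp. $\Delta_2^*$) by $\Lambda_2^n=\sum_{s\ge0}\binom ns\Delta_2^{n-s}$ (resp. $\Lambda_2^{-n}=\sum_{s\ge0}\binom ns(\Delta_2^*)^{n-s}$), $n\in\mathbb Z$; $\iota_{\Lambda_1^{\pm1}}$ means expansion in powers of $\Lambda_1^{\pm1}$ with orders bounded below in that variable. $\partial_{t_k^{(i)}}$ acts on operators coefficientwise. Define the wave operators $S_1(\Lambda_1)=\sum_{n\ge0}a^{(1)}_n(\bm m)\Lambda_1^{-n}$, $S_2(\Lambda_2)=\sum_{n\ge0}a^{(2)}_n(\bm m)\Lambda_2^{n}$, $S_3(\Lambda_1)=\sum_{n\ge0}a^{(3)}_n(\bm m)\Lambda_1^{n}$, $S_3(\Lambda_2^{-1})=\sum_{n\ge0}a^{(3)}_n(\bm m)\Lambda_2^{-n}$, where $$\sum_n a_n^{(1)}z^{-n}=\frac{\tau_{\bm m}(t-[z^{-1}]_1)}{\tau_{\bm m}(t)},\quad \sum_n a_n^{(2)}z^{n}=\frac{\tau_{\bm m+\bm e}(t-[z]_2)}{\tau_{\bm m}(t)},\quad \sum_n a_n^{(3)}z^{n}=(-1)^{m_2}\frac{\tau_{\bm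 m+\bm e_1}(t-[z]_3)}{\tau_{\bm m}(t)},$$ the Lax operators $L_1=S_1\Lambda_1S_1^{-1}$, $L_2=S_2\Lambda_2^{-1}S_2^{-1}$, $L_3(\Lambda_1)=S_3(\Lambda_1)\Lambda_1^{-1}S_3(\Lambda_1)^{-1}$, $L_3(\Lambda_2^{-1})=S_3(\Lambda_2^{-1})\Lambda_2S_3(\Lambda_2^{-1})^{-1}$, and $$B_k^{(1)}=(L_1^k)_{1,\ge0},\quad B_k^{(2)}=(L_2^k)_{\Delta_2^*,\ge1},\quad B_k^{(3)}(\Lambda_1)=(L_3(\Lambda_1)^k)_{1,<0},\quad B_k^{(3)}(\Lambda_2^{-1})=(L_3(\Lambda_2^{-1})^k)_{\Delta_2,\ge1}.$$ Let $\rho=\dfrac{\tau_{\bm m}}{\tau_{\bm m+\bm e_1}}\dfrac{\tau_{\bm m+\bm e+\bm e_1}}{\tau_{\bm m+\bm e}}$ and $H=\Lambda_1\Delta_2+\rho$. Then for every $k\ge1$, $$\partial_{t_k^{(1)}}H=C^{(1)}H-H B_k^{(1)},\qquad \partial_{t_k^{(2)}}H=C^{(2)}H-H B_k^{(2)},$$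 $$\partial_{t_k^{(3)}}H=C^{(3)}(\Lambda_1)H-H B_k^{(3)}(\Lambda_1)=C^{(3)}(\Lambda_2)H-H B_k^{(3)}(\Lambda_2^{-1}),$$ where $$C^{(1)}=\big((\Lambda_1-\rho)L_1^k\,\iota_{\Lambda_1^{-1}}(\Lambda_1-\rho)^{-1}\big)_{1,\ge0},$$ $$C^{(2)}=\big(\rho L_2^k\rho^{-1}\big)_{2,\le0}-\big((\Delta_2^*)^{-1}\Lambda_2^{-1}\rho L_2^k\rho^{-1}\big)_{2,[0]},$$ $$C^{(3)}(\Lambda_1)=\big((\Lambda_1-\rho)L_3(\Lambda_1)^k\,\iota_{\Lambda_1}(\Lambda_1-\rho)^{-1}\big)_{1,<0},$$ $$C^{(3)}(\Lambda_2)=\big(\rho L_3(\Lambda_2^{-1})^k\rho^{-1}\big)_{2,\ge0}-\big(\Delta_2^{-1}\Lambda_2\,\rho L_3(\Lambda_2^{-1})^k\rho^{-1}\big)_{2,[0]}.$$ -/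

import Mathlib

namespace ThreeKP

noncomputable section

/-! ### Time variables, formal functions of the times, time derivatives -/

/-- Index set of the times: `(i, k)` stands for `t_k^{(i+1)}`, with `i = 0, 1, 2` and `k ≥ 1`. -/
abbrev Time := Fin 3 × ℕ+

/-- Formal power series in all the times `t = (t^{(1)}, t^{(2)}, t^{(3)})`. -/
abbrev TimeSeries := MvPowerSeries Time ℂ

/-- Quotients of formal power series in the times. -/
abbrev TimeField := FractionRing TimeSeries

/-- The partial derivative `∂/∂t_k^{(i)}` on quotients of power series, by the quotient rule. -/
def timeDeriv (p : Time) (x : TimeField) : TimeField :=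
  let a : TimeSeries := (IsLocalization.sec (nonZeroDivisors TimeSeries) x).1
  let b : TimeSeries := (IsLocalization.sec (nonZeroDivisors TimeSeries) x).2
  algebraMap TimeSeries TimeField (MvPowerSeries.pderiv ℂ p a * b - a * MvPowerSeries.pderiv ℂ p b) /
    algebraMap TimeSeries TimeField b ^ 2

/-- The value of `timeDeriv` does not depend on how an element is written as a quotient. -/
theorem timeDeriv_div (p : Time) (a b : TimeSeries) (hb : b ≠ 0) :
    timeDeriv p (algebraMap TimeSeries TimeField a / algebraMap TimeSeries TimeField b) =
      algebraMap TimeSeries TimeField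
        (MvPowerSeries.pderiv ℂ p a * b - a * MvPowerSeries.pderiv ℂ p b) /
        algebraMap TimeSeries TimeField b ^ 2 := by
  set x : TimeField := algebraMap TimeSeries TimeField a / algebraMap TimeSeries TimeField b with hx
  have hinj : Function.Injective (algebraMap TimeSeries TimeField) :=
    IsFractionRing.injective TimeSeries TimeField
  have hs := IsLocalization.sec_spec (nonZeroDivisors TimeSeries) x
  unfold timeDeriv
  simp only
  generalize (IsLocalization.sec (nonZeroDivisors TimeSeries) x).1 = c at hs ⊢
  generalize (IsLocalization.sec (nonZeroDivisors TimeSeries) x).2 = d at hs ⊢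
  obtain ⟨d, hd⟩ := d
  simp only at hs ⊢
  have hd0 : d ≠ 0 := nonZeroDivisors.ne_zero hd
  have hB : algebraMap TimeSeries TimeField b ≠ 0 := by
    simpa using hinj.ne hb
  have hD : algebraMap TimeSeries TimeField d ≠ 0 := by
    simpa using hinj.ne hd0
  have hcross : a * d = c * b := by
    apply hinj
    rw [map_mul, map_mul, ← hs, hx]
    field_simp
  have hder := congrArg (MvPowerSeries.pderiv ℂ p) hcross
  simp only [Derivation.leibniz, smul_eq_mul] at hder
  rw [div_eq_div_iff (pow_ne_zero 2 hD) (pow_ne_zero 2 hB), ← map_pow, ← map_pow, ← map_mul,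
    ← map_mul]
  congr 1
  generalize MvPowerSeries.pderiv ℂ p a = a' at *
  generalize MvPowerSeries.pderiv ℂ p b = b' at *
  generalize MvPowerSeries.pderiv ℂ p c = c' at *
  generalize MvPowerSeries.pderiv ℂ p d = d' at *
  linear_combination (-(b * d)) * hder + (b * d' + b' * d) * hcross

/-! ### The bilinear equation -/

/-- The substitution `t ↦ t + c [z]_i`, that is `t_k^{(i)} ↦ t_k^{(i)} + c z^k / k`, the times of
the other components being fixed; the extra variable `none` is `z`. -/
def shiftVar (i : Fin 3) (c : ℂ) (p : Time) : MvPowerSeries (Option Time) ℂ :=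
  MvPowerSeries.X (some p) +
    if p.1 = i then
      MvPowerSeries.C (c / (p.2 : ℕ) : ℂ) * MvPowerSeries.X none ^ (p.2 : ℕ)
    else 0

/-- The coefficient of `z ^ n` in `f (t + c [z]_i)`. -/
def shiftCoeff (i : Fin 3) (c : ℂ) (f : TimeSeries) (n : ℕ) : TimeSeries :=
  fun d => MvPowerSeries.coeff (d.mapDomain some + Finsupp.single none n)
    (MvPowerSeries.subst (shiftVar i c) f)

/-- Formal power series in the two independent sets of times `t` (`Sum.inl`) and `t'`
(`Sum.inr`). -/
abbrev TwoTimeSeries := MvPowerSeries (Time ⊕ Time) ℂ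

instance : Filter.TendstoCofinite (Sum.inl : Time → Time ⊕ Time) :=
  ⟨Sum.inl_injective.tendsto_cofinite⟩

instance : Filter.TendstoCofinite (Sum.inr : Time → Time ⊕ Time) :=
  ⟨Sum.inr_injective.tendsto_cofinite⟩

/-- `ξ(t^{(i)} - t'^{(i)}, z) = ∑_{k ≥ 1} (t_k^{(i)} - t'_k^{(i)}) z ^ k`, as a series in `z`. -/
def xiDiff (i : Fin 3) : PowerSeries TwoTimeSeries :=
  PowerSeries.mk fun k =>
    if h : 0 < k then
      MvPowerSeries.X (Sum.inl (i, ⟨k, h⟩)) - MvPowerSeries.X (Sum.inr (i, ⟨k, h⟩))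
    else 0

/-- The coefficient of `z ^ n` in `exp (ξ(t^{(i)} - t'^{(i)}, z))`. As `ξ` has no constant term
in `z`, only its powers `ξ ^ r / r!` with `r ≤ n` contribute. -/
def expXi (i : Fin 3) (n : ℕ) : TwoTimeSeries :=
  ∑ r ∈ Finset.range (n + 1),
    ((Nat.factorial r : ℂ)⁻¹) • PowerSeries.coeff n (xiDiff i ^ r)

/-- The coefficient of `z ^ l` in `f (t - [z]_i) * g (t' + [z]_i)`, for an integer `l`. -/
def pairCoeff (i : Fin 3) (f g : TimeSeries) (l : ℤ) : TwoTimeSeries :=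
  if 0 ≤ l then
    ∑ q ∈ Finset.HasAntidiagonal.antidiagonal l.toNat,
      MvPowerSeries.rename Sum.inl (shiftCoeff i (-1) f q.1) *
        MvPowerSeries.rename Sum.inr (shiftCoeff i 1 g q.2)
  else 0

/-- `∮_{C_R} dz/(2πi) z ^ a e^{ξ(t^{(i)} - t'^{(i)}, z)} f (t - [z⁻¹]_i) g (t' + [z⁻¹]_i)`, that is
the coefficient of `z⁻¹`. For each monomial in `t, t'` only finitely many `n` contribute. -/
def resInfty (i : Fin 3) (a : ℤ) (f g : TimeSeries) : TwoTimeSeries :=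
  fun d => ∑ᶠ n : ℕ, MvPowerSeries.coeff d (expXi i n * pairCoeff i f g (n + a + 1))

/-- `∮_{C_r} dz/(2πi) z ^ a e^{ξ(t^{(i)} - t'^{(i)}, z⁻¹)} f (t - [z]_i) g (t' + [z]_i)`, that is
the coefficient of `z⁻¹`. For each monomial in `t, t'` only finitely many `n` contribute. -/
def resZero (i : Fin 3) (a : ℤ) (f g : TimeSeries) : TwoTimeSeries :=
  fun d => ∑ᶠ n : ℕ, MvPowerSeries.coeff d (expXi i n * pairCoeff i f g (n - a - 1))

/-- The lattice of the discrete variables `m = (m₁, m₂)`. -/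
abbrev Site := ℤ × ℤ

/-- The bilinear equation of the three-component KP hierarchy for the tau functions `τ_m(t)`. -/
def IsThreeKPTau (τ : Site → TimeSeries) : Prop :=
  ∀ m m' : Site,
    resInfty 0 (m.1 - m'.1) (τ m) (τ m') =
      resZero 1 (m.2 - m'.2) (τ (m + (1, 1))) (τ (m' - (1, 1))) +
      ((-1 : ℂ) ^ (m.2 + m'.2)) •
        resZero 2 (m.1 - m.2 - m'.1 + m'.2) (τ (m + (1, 0))) (τ (m' - (1, 0)))

/-! ### Formal operators in the shifts `Λ₁, Λ₂` -/

/-- A formal operator `∑ a_j(m) Λ₁ ^ j₁ Λ₂ ^ j₂`, given by its coefficients: `A j m = a_j(m)`. -/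
def Op : Type := Site → Site → TimeField

namespace Op

instance : AddCommGroup Op := inferInstanceAs (AddCommGroup (Site → Site → TimeField))

/-- The operator of multiplication by a function of `m` (and `t`). -/
def fn (f : Site → TimeField) : Op := fun j m => if j = 0 then f m else 0

/-- `Λ₁ ^ v₁ Λ₂ ^ v₂`. -/
def shift (v : Site) : Op := fun j _ => if j = v then 1 else 0

instance : One Op := ⟨fn 1⟩

/-- The product of operators, determined by `Λ ^ p · b(m) = b(m + p) Λ ^ p`; it is used only for
operators for which every coefficient of the product is a finite sum. -/
instance : Mul Op := ⟨fun A B j m => ∑ᶠ p : Site, A p m * B (j - p) (m + p)⟩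

instance : Pow Op ℕ := ⟨fun A k => npowRec k A⟩

/-- The coefficientwise derivative with respect to a time. -/
def tderiv (p : Time) (A : Op) : Op := fun j m => timeDeriv p (A j m)

/-- `A_{1,P}`: the terms whose `Λ₁`-order satisfies `P`. -/
def part₁ (P : ℤ → Prop) [DecidablePred P] (A : Op) : Op :=
  fun j m => if P j.1 then A j m else 0

/-- `A_{2,P}`: the terms whose `Λ₂`-order satisfies `P`. -/
def part₂ (P : ℤ → Prop) [DecidablePred P] (A : Op) : Op :=
  fun j m => if P j.2 then A j m else 0

/-- The one-variable series `∑_{n ≥ 0} c_n(m) Q ^ n` in the shift `Q = Λ ^ v`. -/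
def series (v : Site) (c : ℕ → Site → TimeField) : Op :=
  fun j m => ∑ᶠ n : ℕ, if j = n • v then c n m else 0

/-- The coefficients `b_n` of the inverse of `∑_{n ≥ 0} c_n Q ^ n`, `Q = Λ ^ v`, for `c_0` without
zeros, from `b_0 c_0 = 1` and `∑_{p ≤ n} b_p(m) c_{n-p}(m + p v) = 0` for `n ≥ 1`. -/
def invCoeff (v : Site) (c : ℕ → Site → TimeField) (n : ℕ) (m : Site) : TimeField :=
  ((if n = 0 then 1 else 0) -
    ∑ p : Fin n, invCoeff v c p.1 m * c (n - p.1) (m + p.1 • v)) / c 0 (m + n • v)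
termination_by n
decreasing_by exact p.2

/-- The inverse, as a series in increasing powers of `Q = Λ ^ v`, of an operator
`A = ∑_{n ≥ 0} a_n(m) Q ^ (N + n)` whose leading coefficient `a_0` has no zeros: writing
`A = A' Q ^ N`, this is `Q ^ (-N) A'⁻¹`. -/
def inv (v : Site) (N : ℤ) (A : Op) : Op :=
  shift (-(N • v)) * series v (invCoeff v fun n => A ((N + n) • v))

def Λ₁ : Op := shift (1, 0)
def Λ₂ : Op := shift (0, 1)
def Λ₁inv : Op := shift (-1, 0)
def Λ₂inv : Op := shift (0, -1)

/-- `Δ₂ = Λ₂ - 1`. -/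
def Δ₂ : Op := Λ₂ - 1

/-- `Δ₂^* = Λ₂⁻¹ - 1`. -/
def Δ₂star : Op := Λ₂inv - 1

/-- `Δ₂⁻¹ = ∑_{j ≥ 1} Λ₂ ^ (-j)`. -/
def Δ₂Inv : Op := series (0, -1) fun n _ => if 1 ≤ n then 1 else 0

/-- `(Δ₂^*)⁻¹ = ∑_{j ≥ 1} Λ₂ ^ j`. -/
def Δ₂starInv : Op := series (0, 1) fun n _ => if 1 ≤ n then 1 else 0

/-- The coefficient (an operator without `Λ₂`) of `Δ₂ ^ q` when `A` is rewritten in powers of `Δ₂`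
by means of `Λ₂ ^ n = (Δ₂ + 1) ^ n = ∑_{s ≥ 0} (n choose s) Δ₂ ^ (n - s)`, `n ∈ ℤ`; for `A` whose
`Λ₂`-orders are bounded above. -/
def Δ₂coeff (A : Op) (q : ℤ) : Op :=
  fun j m => if j.2 = 0 then ∑ᶠ s : ℕ, Ring.choose (q + s) s • A (j.1, q + s) m else 0

/-- The coefficient (an operator without `Λ₂`) of `(Δ₂^*) ^ q` when `A` is rewritten in powers of
`Δ₂^*` by means of `Λ₂ ^ (-n) = (Δ₂^* + 1) ^ n = ∑_{s ≥ 0} (n choose s) (Δ₂^*) ^ (n - s)`,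
`n ∈ ℤ`; for `A` whose `Λ₂`-orders are bounded below. -/
def Δ₂starCoeff (A : Op) (q : ℤ) : Op :=
  fun j m => if j.2 = 0 then ∑ᶠ s : ℕ, Ring.choose (q + s) s • A (j.1, -(q + s)) m else 0

/-- `A_{Δ₂, ≥ 1}`: the part of `A` of positive order with respect to `Δ₂`. -/
def Δ₂part (A : Op) : Op := ∑ᶠ q : ℕ, if 1 ≤ q then Δ₂coeff A q * Δ₂ ^ q else 0

/-- `A_{Δ₂^*, ≥ 1}`: the part of `A` of positive order with respect to `Δ₂^*`. -/
def Δ₂starPart (A : Op) : Op :=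
  ∑ᶠ q : ℕ, if 1 ≤ q then Δ₂starCoeff A q * Δ₂star ^ q else 0

end Op

open Op

/-! ### Wave operators, Lax operators and the operator `H` -/

/-- A tau function as an element of the field of quotients. -/
def tauQ (f : TimeSeries) : TimeField := algebraMap TimeSeries TimeField f

/-- `S₁ = ∑ a_n(m) Λ₁ ^ (-n)` with `∑ a_n(m) z ^ (-n) = τ_m(t - [z⁻¹]_1) / τ_m(t)`. -/
def S₁ (τ : Site → TimeSeries) : Op :=
  series (-1, 0) fun n m => tauQ (shiftCoeff 0 (-1) (τ m) n) / tauQ (τ m)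

/-- `S₂ = ∑ a_n(m) Λ₂ ^ n` with `∑ a_n(m) z ^ n = τ_{m+e}(t - [z]_2) / τ_m(t)`, `e = (1, 1)`. -/
def S₂ (τ : Site → TimeSeries) : Op :=
  series (0, 1) fun n m => tauQ (shiftCoeff 1 (-1) (τ (m + (1, 1))) n) / tauQ (τ m)

/-- The coefficients of `z ^ n` in `(-1) ^ m₂ τ_{m+e₁}(t - [z]_3) / τ_m(t)`. -/
def waveCoeff₃ (τ : Site → TimeSeries) (n : ℕ) (m : Site) : TimeField :=
  (-1) ^ m.2 * tauQ (shiftCoeff 2 (-1) (τ (m + (1, 0))) n) / tauQ (τ m)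

/-- `S₃(m, Λ₁)`. -/
def S₃ (τ : Site → TimeSeries) : Op := series (1, 0) (waveCoeff₃ τ)

/-- `S₃(m, Λ₂⁻¹)`: the same coefficients, with `Λ₁` replaced by `Λ₂⁻¹`. -/
def S₃' (τ : Site → TimeSeries) : Op := series (0, -1) (waveCoeff₃ τ)

/-- `L₁(Λ₁) = S₁ Λ₁ S₁⁻¹`. -/
def L₁ (τ : Site → TimeSeries) : Op := S₁ τ * Λ₁ * inv (-1, 0) 0 (S₁ τ)

/-- `L₂(Λ₂) = S₂ Λ₂⁻¹ S₂⁻¹`. -/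
def L₂ (τ : Site → TimeSeries) : Op := S₂ τ * Λ₂inv * inv (0, 1) 0 (S₂ τ)

/-- `L₃(Λ₁) = S₃(Λ₁) Λ₁⁻¹ S₃(Λ₁)⁻¹`. -/
def L₃ (τ : Site → TimeSeries) : Op := S₃ τ * Λ₁inv * inv (1, 0) 0 (S₃ τ)

/-- `L₃(Λ₂⁻¹) = S₃(Λ₂⁻¹) Λ₂ S₃(Λ₂⁻¹)⁻¹`. -/
def L₃' (τ : Site → TimeSeries) : Op := S₃' τ * Λ₂ * inv (0, -1) 0 (S₃' τ)

/-- `B_k^{(1)} = (L₁ ^ k)_{1, ≥ 0}`. -/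
def B₁ (τ : Site → TimeSeries) (k : ℕ) : Op := part₁ (fun j => 0 ≤ j) (L₁ τ ^ k)

/-- `B_k^{(2)} = (L₂ ^ k)_{Δ₂^*, ≥ 1}`. -/
def B₂ (τ : Site → TimeSeries) (k : ℕ) : Op := Δ₂starPart (L₂ τ ^ k)

/-- `B_k^{(3)}(Λ₁) = (L₃(Λ₁) ^ k)_{1, < 0}`. -/
def B₃ (τ : Site → TimeSeries) (k : ℕ) : Op := part₁ (fun j => j < 0) (L₃ τ ^ k)

/-- `B_k^{(3)}(Λ₂⁻¹) = (L₃(Λ₂⁻¹) ^ k)_{Δ₂, ≥ 1}`. -/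
def B₃' (τ : Site → TimeSeries) (k : ℕ) : Op := Δ₂part (L₃' τ ^ k)

/-- `ρ = τ_m τ_{m+e+e₁} / (τ_{m+e₁} τ_{m+e})`, with `e₁ = (1, 0)` and `e = (1, 1)`. -/
def rho (τ : Site → TimeSeries) (m : Site) : TimeField :=
  tauQ (τ m) / tauQ (τ (m + (1, 0))) *
    (tauQ (τ (m + (1, 1) + (1, 0))) / tauQ (τ (m + (1, 1))))

/-- `H = Λ₁ Δ₂ + ρ`. -/
def H (τ : Site → TimeSeries) : Op := Λ₁ * Δ₂ + fn (rho τ)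

/-- `Λ₁ - ρ`. -/
def Λ₁subRho (τ : Site → TimeSeries) : Op := Λ₁ - fn (rho τ)

/-- `C^{(1)} = ((Λ₁ - ρ) L₁ ^ k (Λ₁ - ρ)⁻¹)_{1, ≥ 0}`, with `(Λ₁ - ρ)⁻¹` expanded in powers of
`Λ₁⁻¹`. -/
def C₁ (τ : Site → TimeSeries) (k : ℕ) : Op :=
  part₁ (fun j => 0 ≤ j) (Λ₁subRho τ * L₁ τ ^ k * inv (-1, 0) (-1) (Λ₁subRho τ))

/-- `C^{(2)} = (ρ L₂ ^ k ρ⁻¹)_{2, ≤ 0} - ((Δ₂^*)⁻¹ Λ₂⁻¹ ρ L₂ ^ k ρ⁻¹)_{2, [0]}`. -/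
def C₂ (τ : Site → TimeSeries) (k : ℕ) : Op :=
  part₂ (fun j => j ≤ 0) (fn (rho τ) * L₂ τ ^ k * fn (rho τ)⁻¹) -
    part₂ (fun j => j = 0)
      (Δ₂starInv * Λ₂inv * fn (rho τ) * L₂ τ ^ k * fn (rho τ)⁻¹)

/-- `C^{(3)}(Λ₁) = ((Λ₁ - ρ) L₃(Λ₁) ^ k (Λ₁ - ρ)⁻¹)_{1, < 0}`, with `(Λ₁ - ρ)⁻¹` expanded in powers
of `Λ₁`. -/
def C₃ (τ : Site → TimeSeries) (k : ℕ) : Op :=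
  part₁ (fun j => j < 0) (Λ₁subRho τ * L₃ τ ^ k * inv (1, 0) 0 (Λ₁subRho τ))

/-- `C^{(3)}(Λ₂) = (ρ L₃(Λ₂⁻¹) ^ k ρ⁻¹)_{2, ≥ 0} - (Δ₂⁻¹ Λ₂ ρ L₃(Λ₂⁻¹) ^ k ρ⁻¹)_{2, [0]}`. -/
def C₃' (τ : Site → TimeSeries) (k : ℕ) : Op :=
  part₂ (fun j => 0 ≤ j) (fn (rho τ) * L₃' τ ^ k * fn (rho τ)⁻¹) -
    part₂ (fun j => j = 0)
      (Δ₂Inv * Λ₂ * fn (rho τ) * L₃' τ ^ k * fn (rho τ)⁻¹)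

end

end ThreeKP

/-!
At equal times the bilinear equation and its first time derivatives say that certain triples of
series in the spectral parameter, one for each component, pair to zero with all dual wave functions
and their shifts. The leading coefficients of the dual wave functions do not vanish, so such a
triple is zero as soon as its order is high enough in every component. Applied to `H Ψ`, where `Ψ`
is the wave function, this gives the linear equation `H Ψ = 0`; applied to the defect
`∂Ψ - B Ψ`, in which `B` is the part of `L ^ k` that makes the order high, it gives the evolution
`∂S = B S - S Λ ^ (-k v)` of each wave operator `S`, a series in `Λ ^ v`.

In terms of `S` the linear equation is an intertwining relation `T S = F S Y` with `H = ± (F - T)`,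
where `F` and `Y` have constant coefficients. It implies `T L ^ k T⁻¹ = F L ^ k F⁻¹`, and
differentiating it gives `∂H = (F B F⁻¹) H - H B`. The operator `F` is a shift up to sign, times
`1 - Λ ^ v` when `v` points along `Λ₂`, so conjugation by it interacts well with taking parts, and
`F B F⁻¹` is the operator `C` formed from `T L ^ k T⁻¹`.
-/

namespace ThreeKP

noncomputable section

/-! ### The time derivations -/

theorem tauQ_ne_zero {f : TimeSeries} (hf : f ≠ 0) : tauQ f ≠ 0 := by
  simpa [tauQ] using (IsFractionRing.injective TimeSeries TimeField).ne hf

theorem exists_eq_tauQ_div (x : TimeField) : ∃ a b : TimeSeries, b ≠ 0 ∧ x = tauQ a / tauQ b := by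
  obtain ⟨a, b, hb, rfl⟩ := IsFractionRing.div_surjective (A := TimeSeries) x
  exact ⟨a, b, nonZeroDivisors.ne_zero hb, rfl⟩

theorem timeDeriv_add (p : Time) (x y : TimeField) :
    timeDeriv p (x + y) = timeDeriv p x + timeDeriv p y := by
  obtain ⟨a, b, hb, rfl⟩ := exists_eq_tauQ_div x
  obtain ⟨c, d, hd, rfl⟩ := exists_eq_tauQ_div y
  have hB := tauQ_ne_zero hb
  have hD := tauQ_ne_zero hd
  unfold tauQ at *
  rw [div_add_div _ _ hB hD, ← map_mul, ← map_mul, ← map_mul, ← map_add,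
    timeDeriv_div _ _ _ (mul_ne_zero hb hd), timeDeriv_div _ _ _ hb, timeDeriv_div _ _ _ hd]
  simp only [map_sub, map_mul, map_add, Derivation.leibniz, smul_eq_mul]
  field_simp
  ring

theorem timeDeriv_mul (p : Time) (x y : TimeField) :
    timeDeriv p (x * y) = x * timeDeriv p y + y * timeDeriv p x := by
  obtain ⟨a, b, hb, rfl⟩ := exists_eq_tauQ_div x
  obtain ⟨c, d, hd, rfl⟩ := exists_eq_tauQ_div y
  have hB := tauQ_ne_zero hb
  have hD := tauQ_ne_zero hd
  unfold tauQ at *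
  rw [div_mul_div_comm, ← map_mul, ← map_mul,
    timeDeriv_div _ _ _ (mul_ne_zero hb hd), timeDeriv_div _ _ _ hb, timeDeriv_div _ _ _ hd]
  simp only [map_sub, map_mul, map_add, Derivation.leibniz, smul_eq_mul]
  field_simp
  ring

theorem timeDeriv_tauQ (p : Time) (f : TimeSeries) :
    timeDeriv p (tauQ f) = tauQ (MvPowerSeries.pderiv ℂ p f) := by
  simpa [tauQ] using timeDeriv_div p f 1 one_ne_zero

/-- The partial derivative `∂/∂t_k^{(i)}` as a derivation of the field of quotients. -/
def timeDerivation (p : Time) : Derivation ℂ TimeField TimeField :=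
  Derivation.mk'
    { toFun := timeDeriv p
      map_add' := timeDeriv_add p
      map_smul' := fun c x => by
        have h : timeDeriv p (algebraMap ℂ TimeField c) = 0 := by
          rw [IsScalarTower.algebraMap_apply ℂ TimeSeries TimeField, ← tauQ, timeDeriv_tauQ,
            Derivation.map_algebraMap, tauQ, map_zero]
        rw [Algebra.smul_def, timeDeriv_mul, h, mul_zero, add_zero, RingHom.id_apply,
          Algebra.smul_def] }
    (timeDeriv_mul p)

theorem timeDerivation_apply (p : Time) (x : TimeField) : timeDerivation p x = timeDeriv p x := rfl

theorem timeDerivation_tauQ (p : Time) (f : TimeSeries) :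
    timeDerivation p (tauQ f) = tauQ (MvPowerSeries.pderiv ℂ p f) :=
  timeDeriv_tauQ p f

/-! ### Components of the order along a unit step -/

/-- A step of length one along one of the two axes of the lattice. The four unit steps are the
directions in which the wave operators expand. -/
class IsUnitStep (v : Site) : Prop where
  norm_eq_one : v.1 * v.1 + v.2 * v.2 = 1

instance : IsUnitStep (1, 0) := ⟨rfl⟩
instance : IsUnitStep (-1, 0) := ⟨rfl⟩
instance : IsUnitStep (0, 1) := ⟨rfl⟩
instance : IsUnitStep (0, -1) := ⟨rfl⟩

/-- The component of `j` along `v`. -/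
def along (v : Site) : Site →+ ℤ :=
  AddMonoidHom.mk' (fun j => v.1 * j.1 + v.2 * j.2) fun i j => by
    simp only [Prod.fst_add, Prod.snd_add]
    ring

/-- The component of `j` across `v`. -/
def across (v : Site) : Site →+ ℤ :=
  AddMonoidHom.mk' (fun j => v.2 * j.1 - v.1 * j.2) fun i j => by
    simp only [Prod.fst_add, Prod.snd_add]
    ring

theorem along_apply (v j : Site) : along v j = v.1 * j.1 + v.2 * j.2 := rfl

theorem across_apply (v j : Site) : across v j = v.2 * j.1 - v.1 * j.2 := rfl

@[simp] theorem across_self (v : Site) : across v v = 0 := by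
  rw [across_apply]
  ring

section

variable (v : Site) [hv : IsUnitStep v]

@[simp] theorem along_self : along v v = 1 := hv.norm_eq_one

theorem eq_of_along_eq_of_across_eq {i j : Site} (h₁ : along v i = along v j)
    (h₂ : across v i = across v j) : i = j := by
  have h := hv.norm_eq_one
  rw [along_apply, along_apply] at h₁
  rw [across_apply, across_apply] at h₂
  ext
  · linear_combination v.1 * h₁ + v.2 * h₂ + (j.1 - i.1) * h
  · linear_combination v.2 * h₁ - v.1 * h₂ + (j.2 - i.2) * h

theorem eq_along_smul_of_across_eq_zero {j : Site} (h : across v j = 0) : j = along v j • v :=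
  eq_of_along_eq_of_across_eq v (by rw [map_zsmul, along_self, smul_eq_mul, mul_one])
    (by rw [map_zsmul, across_self, smul_zero, h])

theorem finite_setOf_along_across (a b c : ℤ) :
    {p : Site | a ≤ along v p ∧ along v p ≤ b ∧ |across v p| ≤ c}.Finite := by
  refine Set.Finite.of_finite_image (f := fun p => (along v p, across v p))
    (((Set.finite_Icc a b).prod (Set.finite_Icc (-c) c)).subset ?_) ?_
  · rintro _ ⟨p, ⟨h₁, h₂, h₃⟩, rfl⟩
    exact ⟨⟨h₁, h₂⟩, abs_le.1 h₃⟩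
  · intro p _ q _ hpq
    exact eq_of_along_eq_of_across_eq v (congrArg Prod.fst hpq) (congrArg Prod.snd hpq)

end

/-! ### Rings of operators -/

namespace Op

@[ext] theorem ext {A B : Op} (h : ∀ j m, A j m = B j m) : A = B := funext₂ h

protected theorem zero_apply (j m : Site) : (0 : Op) j m = 0 := rfl

protected theorem add_apply (A B : Op) (j m : Site) : (A + B) j m = A j m + B j m := rfl

protected theorem sub_apply (A B : Op) (j m : Site) : (A - B) j m = A j m - B j m := rfl

theorem mul_apply (A B : Op) (j m : Site) :
    (A * B) j m = ∑ᶠ p : Site, A p m * B (j - p) (m + p) := rfl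

theorem fn_mul_apply (f : Site → TimeField) (A : Op) (j m : Site) :
    (fn f * A) j m = f m * A j m := by
  rw [mul_apply, finsum_eq_single _ 0]
  · simp [fn]
  · intro p hp
    simp [fn, hp]

theorem mul_fn_apply (A : Op) (f : Site → TimeField) (j m : Site) :
    (A * fn f) j m = A j m * f (m + j) := by
  rw [mul_apply, finsum_eq_single _ j]
  · simp [fn]
  · intro p hp
    simp [fn, sub_eq_zero, hp.symm]

theorem shift_mul_apply (u : Site) (A : Op) (j m : Site) :
    (shift u * A) j m = A (j - u) (m + u) := by
  rw [mul_apply, finsum_eq_single _ u]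
  · simp [shift]
  · intro p hp
    simp [shift, hp]

theorem mul_shift_apply (A : Op) (u j m : Site) : (A * shift u) j m = A (j - u) m := by
  rw [mul_apply, finsum_eq_single _ (j - u)]
  · simp [shift]
  · intro p hp
    have : j - p ≠ u := fun h => hp (by rw [← h, sub_sub_cancel])
    simp [shift, this]

theorem shift_mul_shift (u w : Site) : shift u * shift w = shift (u + w) := by
  ext j m
  rw [shift_mul_apply]
  simp only [shift, sub_eq_iff_eq_add, add_comm]

/-- The operators whose terms have order at least `a` along `v` and at most `b`, in absolute value,
across `v`. -/
def within (v : Site) (a b : ℤ) : AddSubgroup Op where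
  carrier := {A | ∀ j m, A j m ≠ 0 → a ≤ along v j ∧ |across v j| ≤ b}
  zero_mem' := fun _ _ h => (h rfl).elim
  add_mem' := fun {A B} hA hB j m h => by
    by_cases h₀ : A j m = 0
    · exact hB j m fun h₁ => h (by rw [Op.add_apply, h₀, h₁, add_zero])
    · exact hA j m h₀
  neg_mem' := fun hA j m h => hA j m (neg_ne_zero.1 h)

variable {v : Site} {a b a' b' : ℤ} {A B C : Op}

theorem within_mono (ha : a' ≤ a) (hb : b ≤ b') : within v a b ≤ within v a' b' :=
  fun _ hA j m h => ⟨ha.trans (hA j m h).1, (hA j m h).2.trans hb⟩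

theorem eq_zero_of_mem_within (hA : A ∈ within v a b) {j : Site} (h : along v j < a) (m : Site) :
    A j m = 0 := by
  by_contra h₀
  exact h.not_ge (hA j m h₀).1

theorem across_eq_zero_of_mem_within (hA : A ∈ within v a 0) {j m : Site} (h : A j m ≠ 0) :
    across v j = 0 :=
  abs_nonpos_iff.1 (hA j m h).2

theorem mul_mem_within (hA : A ∈ within v a b) (hB : B ∈ within v a' b') :
    A * B ∈ within v (a + a') (b + b') := fun j m h => by
  obtain ⟨p, hp⟩ : ∃ p, A p m * B (j - p) (m + p) ≠ 0 := by
    by_contra! h₀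
    exact h ((finsum_congr h₀).trans finsum_zero)
  have h₁ := hA p m (left_ne_zero_of_mul hp)
  have h₂ := hB _ _ (right_ne_zero_of_mul hp)
  rw [← add_sub_cancel p j, map_add, map_add]
  exact ⟨add_le_add h₁.1 h₂.1, (abs_add_le _ _).trans (add_le_add h₁.2 h₂.2)⟩

theorem shift_mem_within (v u : Site) : shift u ∈ within v (along v u) |across v u| :=
  fun j m h => by
    obtain rfl : j = u := by
      by_contra h'
      exact h (if_neg h')
    exact ⟨le_rfl, le_rfl⟩

theorem fn_mem_within (v : Site) (f : Site → TimeField) : fn f ∈ within v 0 0 := fun j m h => by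
  obtain rfl : j = 0 := by
    by_contra h'
    exact h (if_neg h')
  simp

/-- The operators whose order is bounded below along `v` and bounded across `v`. -/
def bounded (v : Site) : AddSubgroup Op where
  carrier := {A | ∃ a b, A ∈ within v a b}
  zero_mem' := ⟨0, 0, zero_mem _⟩
  add_mem' := fun ⟨a, b, hA⟩ ⟨a', b', hB⟩ => ⟨min a a', max b b', add_mem
    (within_mono (min_le_left _ _) (le_max_left _ _) hA)
    (within_mono (min_le_right _ _) (le_max_right _ _) hB)⟩
  neg_mem' := fun ⟨a, b, hA⟩ => ⟨a, b, neg_mem hA⟩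

theorem mul_mem_bounded (hA : A ∈ bounded v) (hB : B ∈ bounded v) : A * B ∈ bounded v := by
  obtain ⟨a, b, hA⟩ := hA
  obtain ⟨a', b', hB⟩ := hB
  exact ⟨_, _, mul_mem_within hA hB⟩

theorem finite_setOf_mul_ne_zero [IsUnitStep v] (hA : A ∈ bounded v) (hB : B ∈ bounded v)
    (j : Site) : {p | ∃ m m', A p m ≠ 0 ∧ B (j - p) m' ≠ 0}.Finite := by
  obtain ⟨a, b, hA⟩ := hA
  obtain ⟨a', b', hB⟩ := hB
  refine (finite_setOf_along_across v a (along v j - a') b).subset ?_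
  rintro p ⟨m, m', h₁, h₂⟩
  have h₁ := hA p m h₁
  have h₂ := hB _ _ h₂
  rw [map_sub] at h₂
  exact ⟨h₁.1, by linarith [h₂.1], h₁.2⟩

theorem finite_support_mul [IsUnitStep v] (hA : A ∈ bounded v) (hB : B ∈ bounded v) (j m : Site) :
    (Function.support fun p : Site => A p m * B (j - p) (m + p)).Finite :=
  (finite_setOf_mul_ne_zero hA hB j).subset fun _ hp =>
    ⟨m, _, left_ne_zero_of_mul hp, right_ne_zero_of_mul hp⟩

theorem finite_support_mul_mul [IsUnitStep v] (hA : A ∈ bounded v) (hB : B ∈ bounded v)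
    (hC : C ∈ bounded v) (j m : Site) : (Function.support fun x : Site × Site =>
      A x.1 m * B (x.2 - x.1) (m + x.1) * C (j - x.2) (m + x.2)).Finite := by
  obtain ⟨a, b, hA⟩ := hA
  obtain ⟨a', b', hB⟩ := hB
  obtain ⟨a'', b'', hC⟩ := hC
  refine ((finite_setOf_along_across v a (along v j - a' - a'') b).prod
    (finite_setOf_along_across v (a + a') (along v j - a'') (b + b'))).subset ?_
  rintro ⟨p, q⟩ hpq
  have hA := hA _ _ (left_ne_zero_of_mul (left_ne_zero_of_mul hpq))
  have hB := hB _ _ (right_ne_zero_of_mul (left_ne_zero_of_mul hpq))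
  have hC := hC _ _ (right_ne_zero_of_mul hpq)
  simp only [map_sub, abs_le] at hA hB hC
  simp only [Set.mem_prod, Set.mem_ofPred_eq, abs_le]
  omega

theorem mul_assoc_of_mem_bounded [IsUnitStep v] (hA : A ∈ bounded v) (hB : B ∈ bounded v)
    (hC : C ∈ bounded v) : A * B * C = A * (B * C) := by
  ext j m
  have hfin := finite_support_mul_mul hA hB hC j m
  calc (A * B * C) j m
    _ = ∑ᶠ (q) (p), A p m * B (q - p) (m + p) * C (j - q) (m + q) :=
        finsum_congr fun q => finsum_mul _ _
    _ = ∑ᶠ x : Site × Site, A x.2 m * B (x.1 - x.2) (m + x.2) * C (j - x.1) (m + x.1) :=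
        (finsum_curry _ (hfin.preimage Prod.swap_injective.injOn)).symm
    _ = ∑ᶠ x : Site × Site, A x.1 m * B (x.2 - x.1) (m + x.1) * C (j - x.2) (m + x.2) :=
        finsum_comp_equiv (Equiv.prodComm Site Site)
          (f := fun x => A x.1 m * B (x.2 - x.1) (m + x.1) * C (j - x.2) (m + x.2))
    _ = ∑ᶠ (p) (q), A p m * B (q - p) (m + p) * C (j - q) (m + q) := finsum_curry _ hfin
    _ = (A * (B * C)) j m := finsum_congr fun p => by
        rw [mul_apply, mul_finsum, ← finsum_comp_equiv (Equiv.addLeft p)]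
        simp only [Equiv.coe_addLeft, add_sub_cancel_left, mul_assoc, add_assoc,
          sub_add_eq_sub_sub]

theorem mul_add_of_mem_bounded [IsUnitStep v] (hA : A ∈ bounded v) (hB : B ∈ bounded v)
    (hC : C ∈ bounded v) : A * (B + C) = A * B + A * C := by
  ext j m
  simp only [Op.add_apply, mul_apply, mul_add]
  exact finsum_add_distrib (finite_support_mul hA hB j m) (finite_support_mul hA hC j m)

theorem add_mul_of_mem_bounded [IsUnitStep v] (hA : A ∈ bounded v) (hB : B ∈ bounded v)
    (hC : C ∈ bounded v) : (A + B) * C = A * C + B * C := by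
  ext j m
  simp only [Op.add_apply, mul_apply, add_mul]
  exact finsum_add_distrib (finite_support_mul hA hC j m) (finite_support_mul hB hC j m)

theorem tderiv_mem_within (p : Time) (hA : A ∈ within v a b) : tderiv p A ∈ within v a b :=
  fun j m h => hA j m fun h₀ => h (by rw [tderiv, h₀, ← timeDerivation_apply, map_zero])

theorem tderiv_mul_of_mem_bounded [IsUnitStep v] (p : Time) (hA : A ∈ bounded v)
    (hB : B ∈ bounded v) : tderiv p (A * B) = tderiv p A * B + A * tderiv p B := by
  have hderiv : ∀ {C : Op}, C ∈ bounded v → tderiv p C ∈ bounded v :=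
    fun ⟨a, b, hC⟩ => ⟨a, b, tderiv_mem_within p hC⟩
  ext j m
  calc tderiv p (A * B) j m
    _ = ∑ᶠ q, timeDerivation p (A q m * B (j - q) (m + q)) :=
        AddMonoidHom.map_finsum (timeDerivation p : TimeField →+ TimeField)
          (finite_support_mul hA hB j m)
    _ = ∑ᶠ q, (tderiv p A q m * B (j - q) (m + q) + A q m * tderiv p B (j - q) (m + q)) :=
        finsum_congr fun q => by
          rw [Derivation.leibniz, smul_eq_mul, smul_eq_mul, add_comm, mul_comm (B _ _)]
          rfl
    _ = _ := finsum_add_distrib (finite_support_mul (hderiv hA) hB j m)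
          (finite_support_mul hA (hderiv hB) j m)

/-- The terms whose order along `v` satisfies `P`. -/
def partAlong (v : Site) (P : ℤ → Prop) [DecidablePred P] (A : Op) : Op :=
  fun j m => if P (along v j) then A j m else 0

theorem partAlong_mem_within (P : ℤ → Prop) [DecidablePred P] (hA : A ∈ within v a b) :
    partAlong v P A ∈ within v a b := fun j m h =>
  hA j m fun h₀ => h (by rw [partAlong, h₀, ite_self])

end Op

open Op

/-- The operators whose order is bounded below along `v` and bounded across `v`; for a unit step
`v` they form a ring. -/
abbrev OpRing (v : Site) : Type := bounded v

namespace OpRing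

variable {v : Site}

instance : One (OpRing v) := ⟨⟨1, 0, 0, fn_mem_within v 1⟩⟩

instance : Mul (OpRing v) := ⟨fun A B => ⟨A.1 * B.1, mul_mem_bounded A.2 B.2⟩⟩

@[simp] theorem coe_one : ((1 : OpRing v) : Op) = 1 := rfl

@[simp] theorem coe_mul (A B : OpRing v) : ((A * B : OpRing v) : Op) = A * B := rfl

variable [IsUnitStep v]

instance : Ring (OpRing v) where
  __ : AddCommGroup (OpRing v) := inferInstance
  mul_assoc A B C := Subtype.ext (mul_assoc_of_mem_bounded A.2 B.2 C.2)
  one_mul A := Subtype.ext (by ext j m; exact (fn_mul_apply 1 A.1 j m).trans (one_mul _))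
  mul_one A := Subtype.ext (by ext j m; exact (mul_fn_apply A.1 1 j m).trans (mul_one _))
  left_distrib A B C := Subtype.ext (mul_add_of_mem_bounded A.2 B.2 C.2)
  right_distrib A B C := Subtype.ext (add_mul_of_mem_bounded A.2 B.2 C.2)
  zero_mul A := Subtype.ext (by ext j m; simp [mul_apply, Op.zero_apply])
  mul_zero A := Subtype.ext (by ext j m; simp [mul_apply, Op.zero_apply])

@[simp] theorem coe_pow (A : OpRing v) (k : ℕ) : ((A ^ k : OpRing v) : Op) = (A : Op) ^ k := by
  induction k with
  | zero => rfl
  | succ k ih =>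
    rw [pow_succ, coe_mul, ih]
    rfl

/-- The operator `Λ ^ u`. -/
def sh (v u : Site) : OpRing v := ⟨shift u, _, _, shift_mem_within v u⟩

/-- Multiplication by a function of `m`. -/
def ofFn (v : Site) [IsUnitStep v] : (Site → TimeField) →+* OpRing v where
  toFun f := ⟨fn f, 0, 0, fn_mem_within v f⟩
  map_one' := rfl
  map_mul' f g := Subtype.ext (by ext j m; simp [fn_mul_apply, fn])
  map_zero' := Subtype.ext (by ext j m; simp [fn, Op.zero_apply])
  map_add' f g := Subtype.ext (by ext j m; by_cases h : j = 0 <;> simp [fn, h, Op.add_apply])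

/-- The coefficientwise derivative with respect to a time. -/
def deriv (p : Time) : OpRing v →+ OpRing v where
  toFun A := ⟨tderiv p A.1, A.2.imp fun _ => Exists.imp fun _ => tderiv_mem_within p⟩
  map_zero' := Subtype.ext (funext₂ fun _ _ => map_zero (timeDerivation p))
  map_add' _ _ := Subtype.ext (funext₂ fun _ _ => map_add (timeDerivation p) _ _)

/-- The terms whose order along `v` satisfies `P`. -/
def part (P : ℤ → Prop) [DecidablePred P] : OpRing v →+ OpRing v where
  toFun A := ⟨partAlong v P A.1, A.2.imp fun _ => Exists.imp fun _ => partAlong_mem_within P⟩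
  map_zero' := Subtype.ext (by ext j m; simp [partAlong, Op.zero_apply])
  map_add' A B := Subtype.ext (by
    ext j m
    by_cases h : P (along v j) <;> simp [partAlong, h, Op.add_apply])

end OpRing

namespace OpRing

variable {v : Site}

@[simp] theorem coe_sh (u : Site) : (sh v u : Op) = shift u := rfl

theorem sh_mul_sh (u w : Site) : sh v u * sh v w = sh v (u + w) :=
  Subtype.ext (shift_mul_shift u w)

theorem sh_zero : sh v 0 = 1 := rfl

theorem sh_commute (u w : Site) : Commute (sh v u) (sh v w) := by
  rw [Commute, SemiconjBy, sh_mul_sh, sh_mul_sh, add_comm]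

variable [IsUnitStep v]

@[simp] theorem coe_ofFn (f : Site → TimeField) : (ofFn v f : Op) = fn f := rfl

@[simp] theorem coe_deriv (p : Time) (A : OpRing v) : (deriv p A : Op) = tderiv p A := rfl

@[simp] theorem coe_part (P : ℤ → Prop) [DecidablePred P] (A : OpRing v) :
    (part P A : Op) = partAlong v P A := rfl

theorem deriv_mul (p : Time) (A B : OpRing v) :
    deriv p (A * B) = deriv p A * B + A * deriv p B :=
  Subtype.ext (tderiv_mul_of_mem_bounded p A.2 B.2)

theorem sh_nsmul (n : ℕ) (u : Site) : sh v (n • u) = sh v u ^ n := by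
  induction n with
  | zero => rw [zero_smul, pow_zero, sh_zero]
  | succ n ih => rw [succ_nsmul, ← sh_mul_sh, ih, pow_succ]

/-- The operator `Λ ^ u` as a unit. -/
def shUnit (v : Site) [IsUnitStep v] (u : Site) : (OpRing v)ˣ where
  val := sh v u
  inv := sh v (-u)
  val_inv := by rw [sh_mul_sh, add_neg_cancel, sh_zero]
  inv_val := by rw [sh_mul_sh, neg_add_cancel, sh_zero]

@[simp] theorem coe_shUnit (u : Site) : (shUnit v u : OpRing v) = sh v u := rfl

@[simp] theorem coe_inv_shUnit (u : Site) :
    (((shUnit v u)⁻¹ : (OpRing v)ˣ) : OpRing v) = sh v (-u) := rfl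

theorem deriv_sh (p : Time) (u : Site) : deriv p (sh v u) = 0 :=
  Subtype.ext (funext₂ fun j m => by
    rw [coe_deriv, coe_sh, tderiv, shift, ← timeDerivation_apply]
    split_ifs
    · exact Derivation.map_one_eq_zero _
    · exact map_zero _)

theorem part_sh_mul (P : ℤ → Prop) [DecidablePred P] (u : Site) (A : OpRing v) :
    part P (sh v u * A) = sh v u * part (fun j => P (along v u + j)) A :=
  Subtype.ext (by
    ext j m
    simp [partAlong, shift_mul_apply])

theorem part_mul_sh (P : ℤ → Prop) [DecidablePred P] (u : Site) (A : OpRing v) :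
    part P (A * sh v u) = part (fun j => P (j + along v u)) A * sh v u :=
  Subtype.ext (by
    ext j m
    simp [partAlong, mul_shift_apply])

theorem part_sh_conj (P : ℤ → Prop) [DecidablePred P] (A : OpRing v) (u : Site) :
    part P (sh v u * A * sh v (-u)) =
      sh v u * part P A * sh v (-u) := by
  rw [part_mul_sh, part_sh_mul]
  simp

theorem part_nonpos_one_sub_sh_mul (A : OpRing v) :
    part (· ≤ 0) ((1 - sh v v) * A) - part (· = 0) A =
      (1 - sh v v) * part (· < 0) A := by
  have hsplit : part (· ≤ 0) A = part (· < 0) A + part (· = 0) A := Subtype.ext (by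
    ext j m
    rcases lt_trichotomy (along v j) 0 with h | h | h <;>
      simp only [coe_part, AddSubgroup.coe_add, partAlong, Op.add_apply] <;>
      grind)
  have hshift : part (fun j => along v v + j ≤ 0) A = part (· < 0) A := Subtype.ext (by
    ext j m
    simp only [coe_part, partAlong, along_self, ← Int.add_one_le_iff, add_comm])
  rw [sub_mul, one_mul, map_sub, part_sh_mul, hshift, hsplit, sub_mul, one_mul]
  abel

/-! ### Series in a shift and their inverses -/

theorem series_mem_within (c : ℕ → Site → TimeField) : series v c ∈ within v 0 0 := fun j m h => by
  obtain ⟨n, hn⟩ : ∃ n : ℕ, j = n • v := by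
    by_contra! h'
    exact h ((finsum_congr fun n => if_neg (h' n)).trans finsum_zero)
  rw [hn, map_nsmul, map_nsmul]
  simp

theorem nsmul_injective : Function.Injective fun n : ℕ => n • v := fun a b h => by
  simpa only [map_nsmul, along_self, nsmul_one, Nat.cast_inj] using congrArg (along v) h

theorem series_apply_nsmul (c : ℕ → Site → TimeField) (n : ℕ) (m : Site) :
    series v c (n • v) m = c n m := by
  rw [series, finsum_eq_single _ n fun k hk => if_neg (nsmul_injective.ne hk.symm), if_pos rfl]

theorem ext_of_mem_within {A B : OpRing v} (hA : (A : Op) ∈ within v 0 0)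
    (hB : (B : Op) ∈ within v 0 0)
    (h : ∀ (n : ℕ) (m : Site), (A : Op) (n • v) m = (B : Op) (n • v) m) : A = B := Subtype.ext (by
  have hsub : (A : Op) - B ∈ within v 0 0 := sub_mem hA hB
  ext j m
  by_contra hj
  have h₁ := hsub j m (sub_ne_zero.2 hj)
  obtain ⟨n, hn⟩ := Int.eq_ofNat_of_zero_le h₁.1
  have h₂ := eq_along_smul_of_across_eq_zero v (abs_nonpos_iff.1 h₁.2)
  rw [h₂, hn, natCast_zsmul] at hj
  exact hj (h n m))

theorem mul_apply_nsmul {A B : OpRing v} (hA : (A : Op) ∈ within v 0 0)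
    (hB : (B : Op) ∈ within v 0 0) (n : ℕ) (m : Site) : ((A * B : OpRing v) : Op) (n • v) m =
      ∑ p ∈ Finset.range (n + 1), (A : Op) (p • v) m * (B : Op) ((n - p) • v) (m + p • v) := by
  classical
  have hsupp : (Function.support fun q => (A : Op) q m * (B : Op) (n • v - q) (m + q)) ⊆
      (Finset.range (n + 1)).image fun p => p • v := fun q hq => by
    have h₁ := hA q m (left_ne_zero_of_mul hq)
    have h₂ := (hB _ _ (right_ne_zero_of_mul hq)).1
    rw [map_sub, map_nsmul, along_self, nsmul_one] at h₂
    obtain ⟨p, hp⟩ := Int.eq_ofNat_of_zero_le h₁.1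
    refine Finset.mem_coe.2 (Finset.mem_image.2 ⟨p, Finset.mem_range.2 (by omega), ?_⟩)
    rw [eq_along_smul_of_across_eq_zero v (abs_nonpos_iff.1 h₁.2), hp,
      natCast_zsmul]
  rw [coe_mul, mul_apply, finsum_eq_sum_of_support_subset _ hsupp,
    Finset.sum_image nsmul_injective.injOn]
  refine Finset.sum_congr rfl fun p hp => ?_
  rw [sub_nsmul v (Finset.mem_range_succ_iff.1 hp), sub_eq_add_neg]

/-- The operator `∑ c_n Q ^ n`, `Q = Λ ^ v`. -/
def ser (v : Site) [IsUnitStep v] (c : ℕ → Site → TimeField) : OpRing v :=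
  ⟨series v c, 0, 0, series_mem_within c⟩

@[simp] theorem coe_ser (c : ℕ → Site → TimeField) : (ser v c : Op) = series v c := rfl

theorem ser_invCoeff_mul_ser {c : ℕ → Site → TimeField} (hc : ∀ m, c 0 m ≠ 0) :
    ser v (invCoeff v c) * ser v c = 1 := by
  refine ext_of_mem_within (mul_mem_within (series_mem_within _) (series_mem_within _))
    (fn_mem_within v 1) fun n m => ?_
  have hinv : ∑ p : Fin n, invCoeff v c p m * c (n - p) (m + (p : ℕ) • v) +
      invCoeff v c n m * c 0 (m + n • v) = if n = 0 then 1 else 0 := by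
    rw [invCoeff.eq_1 v c n m, div_mul_cancel₀ _ (hc _), add_sub_cancel]
  rw [mul_apply_nsmul (series_mem_within _) (series_mem_within _), Finset.sum_range_succ,
    ← Fin.sum_univ_eq_sum_range]
  simp only [ser, series_apply_nsmul, Nat.sub_self, hinv]
  exact if_congr (by rw [← zero_nsmul v, nsmul_injective.eq_iff]) rfl rfl

theorem ser_mul_ser_invCoeff {c : ℕ → Site → TimeField} (hc : ∀ m, c 0 m ≠ 0) :
    ser v c * ser v (invCoeff v c) = 1 := by
  have hc' : ∀ m, invCoeff v c 0 m ≠ 0 := fun m => by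
    rw [invCoeff]
    simpa using hc m
  have h := ser_invCoeff_mul_ser (v := v) hc'
  rwa [left_inv_eq_right_inv h (ser_invCoeff_mul_ser hc)] at h

theorem eq_ser_mul_sh {N : ℤ} {A : OpRing v} (hA : (A : Op) ∈ within v N 0) :
    A = ser v (fun n => (A : Op) ((N + n) • v)) * sh v (N • v) := by
  have hline : A * sh v (-(N • v)) = ser v fun n => (A : Op) ((N + n) • v) := by
    refine ext_of_mem_within ?_ (series_mem_within _) fun n m => ?_
    · have h := mul_mem_within hA (shift_mem_within v (-(N • v)))
      rwa [map_neg, map_neg, map_zsmul, map_zsmul, along_self, across_self, smul_zero, neg_zero,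
        abs_zero, smul_eq_mul, mul_one, add_neg_cancel, add_zero] at h
    · rw [coe_mul, coe_sh, mul_shift_apply, coe_ser, series_apply_nsmul, sub_neg_eq_add, add_smul,
        natCast_zsmul, add_comm]
  rw [← hline, mul_assoc, sh_mul_sh, neg_add_cancel, sh_zero, mul_one]

/-- An operator on the line along `v` whose leading coefficient, of order `N`, has no zeros is a
unit. -/
def leadingUnit (N : ℤ) (A : OpRing v) (hA : (A : Op) ∈ within v N 0)
    (h₀ : ∀ m, (A : Op) (N • v) m ≠ 0) : (OpRing v)ˣ where
  val := A
  inv := sh v (-(N • v)) * ser v (invCoeff v fun n => (A : Op) ((N + n) • v))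
  val_inv := by
    conv_lhs => enter [1]; rw [eq_ser_mul_sh hA]
    rw [mul_assoc, ← mul_assoc (sh v _), sh_mul_sh, add_neg_cancel, sh_zero, one_mul,
      ser_mul_ser_invCoeff (by simpa using h₀)]
  inv_val := by
    conv_lhs => enter [2]; rw [eq_ser_mul_sh hA]
    rw [mul_assoc, ← mul_assoc (ser v _), ser_invCoeff_mul_ser (by simpa using h₀), one_mul,
      sh_mul_sh, neg_add_cancel, sh_zero]

theorem coe_inv_leadingUnit_mem_within (N : ℤ) (A : OpRing v) (hA : (A : Op) ∈ within v N 0)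
    (h₀ : ∀ m, (A : Op) (N • v) m ≠ 0) :
    (((leadingUnit N A hA h₀)⁻¹ : (OpRing v)ˣ) : Op) ∈ within v (-N) 0 := by
  refine within_mono ?_ ?_
    (mul_mem_within (shift_mem_within v (-(N • v))) (series_mem_within (v := v) _))
  · rw [map_neg, map_zsmul, along_self, smul_eq_mul, mul_one, add_zero]
  · rw [map_neg, map_zsmul, across_self, smul_zero, neg_zero, abs_zero, add_zero]

end OpRing

/-! ### Dressing -/

section Dressing

variable {R : Type*} [Ring R] {F T Y S E : Rˣ}

theorem conj_eq_conj_of_intertwining (hT : (F * S * Y : R) = T * S) (hEY : Commute E Y) :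
    (T * (S * E * ↑S⁻¹) * ↑T⁻¹ : R) = F * (S * E * ↑S⁻¹) * ↑F⁻¹ := by
  obtain rfl : T = F * S * Y * S⁻¹ := by
    rw [eq_mul_inv_iff_mul_eq]
    exact Units.ext hT.symm
  have hconj : F * S * Y * S⁻¹ * (S * E * S⁻¹) * (F * S * Y * S⁻¹)⁻¹ =
      F * (S * E * S⁻¹) * F⁻¹ := by
    have hYE : Y * E = E * Y := hEY.eq.symm
    simp only [mul_inv_rev, inv_inv, mul_assoc, inv_mul_cancel_left]
    rw [← mul_assoc Y E, hYE]
    simp only [mul_assoc, mul_inv_cancel_left]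
  simpa only [Units.val_mul] using congrArg Units.val hconj

theorem deriv_sub_eq_of_intertwining {D : R →+ R} (hD : ∀ x y, D (x * y) = D x * y + x * D y)
    {B : R} {F S E Y : Rˣ} {T : R} (hT : (F * S * Y : R) = T * S) (hEY : Commute E Y)
    (hS : D S = B * S - S * E) (hF : D F = 0) (hY : D Y = 0) :
    D (F - T) = (F * B * ↑F⁻¹) * (F - T) - (F - T) * B := by
  have hYE : (E * Y : R) = Y * E := congrArg Units.val hEY.eq
  have hTS : D T * S = F * B * S * Y - T * B * S := by
    have h : D T * S + T * D S = F * D S * Y := by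
      simpa only [hD, hF, hY, zero_mul, zero_add, mul_zero, add_zero] using (congrArg D hT).symm
    have hSEY : (F * (S * E) * Y : R) = T * (S * E) := by
      rw [mul_assoc, mul_assoc, hYE, ← mul_assoc, ← mul_assoc, hT, mul_assoc]
    rw [eq_sub_of_add_eq h, hS, mul_sub, mul_sub, sub_mul, hSEY]
    noncomm_ring
  have hSY : (S * Y : R) = ↑F⁻¹ * T * S := by
    rw [mul_assoc, ← hT, mul_assoc, Units.inv_mul_cancel_left]
  have hDT : D T = F * B * ↑F⁻¹ * T - T * B := by
    refine S.isUnit.mul_right_cancel ?_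
    rw [hTS, sub_mul, mul_assoc _ (S : R) Y, hSY]
    simp only [mul_assoc]
  rw [map_sub, hF, hDT, mul_sub, sub_mul, Units.inv_mul_cancel_right]
  abel

end Dressing

namespace OpRing

variable {v : Site} [IsUnitStep v]

/-! ### Parts of positive order in `Λ⁻ᵛ - 1` -/

theorem one_sub_sh_mem_within (v : Site) [IsUnitStep v] :
    ((1 - sh v v : OpRing v) : Op) ∈ within v 0 0 :=
  sub_mem (fn_mem_within v 1) (within_mono (by simp) (by simp) (shift_mem_within v v))

theorem one_apply_nsmul (n : ℕ) (m : Site) : (1 : Op) (n • v) m = if n = 0 then 1 else 0 :=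
  if_congr (by rw [← zero_nsmul v, nsmul_injective.eq_iff]) rfl rfl

theorem series_one_apply_nsmul_sub (n : ℕ) (m : Site) :
    series v 1 (n • v - v) m = if 1 ≤ n then 1 else 0 := by
  cases n with
  | zero => exact eq_zero_of_mem_within (series_mem_within 1) (by simp) m
  | succ n =>
    rw [succ_nsmul, add_sub_cancel_right, series_apply_nsmul, if_pos (Nat.le_add_left 1 n),
      Pi.one_apply, Pi.one_apply]

/-- The unit `1 - Λ ^ v`, whose inverse is the geometric series in `Λ ^ v`. -/
def oneSubSh (v : Site) [IsUnitStep v] : (OpRing v)ˣ where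
  val := 1 - sh v v
  inv := ser v 1
  val_inv := by
    refine ext_of_mem_within (mul_mem_within (one_sub_sh_mem_within v) (series_mem_within 1))
      (fn_mem_within v 1) fun n m => ?_
    rw [sub_mul, one_mul, AddSubgroup.coe_sub, Op.sub_apply, coe_mul, coe_sh, shift_mul_apply,
      coe_ser, series_apply_nsmul, series_one_apply_nsmul_sub, coe_one, one_apply_nsmul]
    cases n <;> simp
  inv_val := by
    refine ext_of_mem_within (mul_mem_within (series_mem_within 1) (one_sub_sh_mem_within v))
      (fn_mem_within v 1) fun n m => ?_
    rw [mul_sub, mul_one, AddSubgroup.coe_sub, Op.sub_apply, coe_mul, coe_sh, mul_shift_apply,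
      coe_ser, series_apply_nsmul, series_one_apply_nsmul_sub, coe_one, one_apply_nsmul]
    cases n <;> simp

@[simp] theorem coe_oneSubSh : (oneSubSh v : OpRing v) = 1 - sh v v := rfl

theorem ser_ite_mul_sh_neg :
    ser v (fun n _ => if 1 ≤ n then 1 else 0) * sh v (-v) = ↑(oneSubSh v)⁻¹ := by
  have h : ser v (fun n _ => if 1 ≤ n then 1 else 0) = ↑(oneSubSh v)⁻¹ * sh v v := by
    refine ext_of_mem_within (series_mem_within _)
      (within_mono (by simp) (by simp)
        (mul_mem_within (series_mem_within 1) (shift_mem_within v v))) fun n m => ?_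
    rw [coe_ser, series_apply_nsmul, coe_mul, coe_sh, mul_shift_apply]
    exact (series_one_apply_nsmul_sub n m).symm
  rw [h, mul_assoc, sh_mul_sh, add_neg_cancel, sh_zero, mul_one]

theorem part_eq_zero_of_mem_within {P : ℤ → Prop} [DecidablePred P] {a b : ℤ} {A : OpRing v}
    (hA : (A : Op) ∈ within v a b) (hP : ∀ j, a ≤ j → ¬ P j) : part P A = 0 :=
  Subtype.ext (by
    ext j m
    rw [coe_part, partAlong]
    split_ifs with h
    · exact eq_zero_of_mem_within hA (lt_of_not_ge fun h' => hP _ h' h) m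
    · rfl)

theorem part_ofFn_mul (P : ℤ → Prop) [DecidablePred P] (f : Site → TimeField) (A : OpRing v) :
    part P (ofFn v f * A) = ofFn v f * part P A :=
  Subtype.ext (by
    ext j m
    simp [partAlong, fn_mul_apply])

theorem part_sh (P : ℤ → Prop) [DecidablePred P] (u : Site) :
    part P (sh v u) = if P (along v u) then sh v u else 0 := by
  refine Subtype.ext (funext₂ fun j m => ?_)
  rw [coe_part, partAlong, coe_sh]
  obtain rfl | hj := eq_or_ne j u
  · split_ifs <;> rfl
  · have hzero : shift u j m = 0 := if_neg hj
    rw [hzero, ite_self]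
    split_ifs
    exacts [hzero.symm, rfl]

/-- The part of an operator of positive order in `Λ ^ (-v) - 1`. -/
def deltaPart : OpRing v →+ OpRing v where
  toFun A := part (· < 0) (A * ↑(oneSubSh v)⁻¹) * (oneSubSh v : OpRing v)
  map_zero' := by simp only [zero_mul, map_zero]
  map_add' A B := by simp only [add_mul, map_add]

theorem deltaPart_eq (A : OpRing v) :
    deltaPart A = part (v := v) (· < 0) (A * ↑(oneSubSh v)⁻¹) * (1 - sh v v) := rfl

theorem deltaPart_of_mem_within {A : OpRing v} (hA : (A : Op) ∈ within v 0 0) :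
    deltaPart A = 0 := by
  rw [deltaPart_eq, part_eq_zero_of_mem_within (mul_mem_within hA (series_mem_within 1))
    (fun j hj => hj.not_gt), zero_mul]

theorem deltaPart_ofFn_mul (f : Site → TimeField) (A : OpRing v) :
    deltaPart (ofFn v f * A) = ofFn v f * deltaPart A := by
  rw [deltaPart_eq, deltaPart_eq, mul_assoc, part_ofFn_mul, mul_assoc]

/-- The function `a` such that `A` contains the term `a Λ ^ (-n v)`. -/
def negCoeff (A : OpRing v) (n : ℕ) : Site → TimeField := (A : Op) (-(n • v))

theorem coe_sum_apply {ι : Type*} (s : Finset ι) (A : ι → OpRing v) (j m : Site) :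
    ((∑ i ∈ s, A i : OpRing v) : Op) j m = ∑ i ∈ s, (A i : Op) j m := by
  classical
  induction s using Finset.induction_on with
  | empty => rfl
  | insert i s hi ih =>
    rw [Finset.sum_insert hi, Finset.sum_insert hi, AddSubgroup.coe_add, Op.add_apply, ih]

theorem ofFn_mul_sh_mem_within (f : Site → TimeField) (u : Site) :
    ((ofFn v f * sh v u : OpRing v) : Op) ∈ within v (along v u) |across v u| := by
  simpa using mul_mem_within (fn_mem_within v f) (shift_mem_within v u)

theorem ofFn_mul_sh_apply (f : Site → TimeField) (u j m : Site) :
    ((ofFn v f * sh v u : OpRing v) : Op) j m = if j = u then f m else 0 := by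
  simp [fn_mul_apply, shift]

/-- The operator `∑ b_n Λ ^ (-n v)`, summed over `n ≤ N`. -/
def negSum (v : Site) [IsUnitStep v] (N : ℕ) (b : ℕ → Site → TimeField) : OpRing v :=
  ∑ n ∈ Finset.range (N + 1), ofFn v (b n) * sh v (-(n • v))

theorem negSum_mem_within (N : ℕ) (b : ℕ → Site → TimeField) :
    (negSum v N b : Op) ∈ within v (-N) 0 := by
  rw [negSum, AddSubgroup.val_finsetSum]
  refine sum_mem fun n hn => within_mono ?_ ?_ (ofFn_mul_sh_mem_within _ _)
  · rw [map_neg, map_nsmul, along_self, nsmul_one, neg_le_neg_iff, Nat.cast_le]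
    exact Finset.mem_range_succ_iff.1 hn
  · rw [map_neg, map_nsmul, across_self, smul_zero, neg_zero, abs_zero]

theorem negCoeff_negSum {n N : ℕ} (hn : n ≤ N) (b : ℕ → Site → TimeField) :
    negCoeff (negSum v N b) n = b n := by
  ext m
  rw [negCoeff, negSum, coe_sum_apply,
    Finset.sum_eq_single_of_mem n (Finset.mem_range_succ_iff.2 hn), ofFn_mul_sh_apply, if_pos rfl]
  intro k _ hk
  rw [ofFn_mul_sh_apply, if_neg fun h => hk (nsmul_injective (neg_injective h)).symm]

theorem sub_negSum_mem_within {N : ℕ} {A : OpRing v} (hA : (A : Op) ∈ within v (-N) 0) :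
    ((A - negSum v N (negCoeff A) : OpRing v) : Op) ∈ within v 1 0 := by
  have hmem : ((A - negSum v N (negCoeff A) : OpRing v) : Op) ∈ within v (-N) 0 :=
    sub_mem hA (negSum_mem_within N _)
  intro j m hj
  refine ⟨?_, (hmem j m hj).2⟩
  by_contra! hpos
  obtain ⟨n, hn⟩ := Int.eq_ofNat_of_zero_le (a := -along v j) (by omega)
  have hnN : n ≤ N := by
    have := (hmem j m hj).1
    omega
  obtain rfl : j = -(n • v) := by
    rw [eq_along_smul_of_across_eq_zero v (across_eq_zero_of_mem_within hmem hj),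
      ← natCast_zsmul, ← hn, neg_smul, neg_neg]
  refine hj ?_
  have h := congrFun (negCoeff_negSum (v := v) hnN (negCoeff A)) m
  rw [AddSubgroup.coe_sub, Op.sub_apply]
  exact sub_eq_zero.2 h.symm

theorem deltaPart_sh_neg_nsmul_sub_one (n : ℕ) :
    deltaPart (sh v (-(n • v)) - 1 : OpRing v) = sh v (-(n • v)) - 1 := by
  have hgeom : (sh v (-(n • v)) - 1 : OpRing v) =
      (∑ q ∈ Finset.range n, sh v (-((n - q) • v))) * (oneSubSh v : OpRing v) := by
    rw [Finset.sum_congr rfl (g := fun q => sh v (-(n • v)) * sh v v ^ q), ← Finset.mul_sum,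
      mul_assoc, coe_oneSubSh, geom_sum_mul_neg, mul_sub, mul_one, ← sh_nsmul, sh_mul_sh,
      neg_add_cancel, sh_zero]
    intro q hq
    rw [← sh_nsmul, sh_mul_sh, sub_nsmul _ (Finset.mem_range.1 hq).le, neg_add_rev, neg_neg,
      add_comm]
  have hpart : part (· < 0) (∑ q ∈ Finset.range n, sh v (-((n - q) • v))) =
      ∑ q ∈ Finset.range n, sh v (-((n - q) • v)) := by
    rw [map_sum]
    refine Finset.sum_congr rfl fun q hq => (part_sh _ _).trans (if_pos ?_)
    rw [map_neg, map_nsmul, along_self, nsmul_one, neg_lt_zero, Nat.cast_pos]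
    exact Nat.sub_pos_of_lt (Finset.mem_range.1 hq)
  rw [hgeom, deltaPart_eq, Units.mul_inv_cancel_right, hpart, coe_oneSubSh]

theorem deltaPart_eq_sum {N : ℕ} {A : OpRing v} (hA : (A : Op) ∈ within v (-N) 0) :
    deltaPart A =
      ∑ n ∈ Finset.range (N + 1), ofFn v (negCoeff A n) * (sh v (-(n • v)) - 1) := by
  set P := negSum v N (negCoeff A) with hP
  set f := ∑ n ∈ Finset.range (N + 1), ofFn v (negCoeff A n) with hf
  have hsum :
      ∑ n ∈ Finset.range (N + 1), ofFn v (negCoeff A n) * (sh v (-(n • v)) - 1) = P - f := by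
    simp only [mul_sub, mul_one, Finset.sum_sub_distrib, hP, hf, negSum]
  have hrest : deltaPart (A - P + f) = 0 := by
    refine deltaPart_of_mem_within (add_mem (within_mono zero_le_one le_rfl
      (sub_negSum_mem_within hA)) ?_)
    rw [hf, ← map_sum]
    exact fn_mem_within v _
  calc deltaPart A
    _ = deltaPart (A - P + f) + deltaPart (P - f) := by rw [← map_add]; congr 1; abel
    _ = deltaPart (P - f) := by rw [hrest, zero_add]
    _ = _ := by simp only [← hsum, map_sum, deltaPart_ofFn_mul, deltaPart_sh_neg_nsmul_sub_one]

theorem deltaPart_eq_negSum_sub {N : ℕ} {A : OpRing v} (hA : (A : Op) ∈ within v (-N) 0) :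
    deltaPart A = negSum v N (negCoeff A) -
      ofFn v (∑ n ∈ Finset.range (N + 1), negCoeff A n) := by
  rw [deltaPart_eq_sum hA, negSum, map_sum, ← Finset.sum_sub_distrib]
  simp only [mul_sub, mul_one]

theorem sub_deltaPart_mem_within {N : ℕ} {A : OpRing v} (hA : (A : Op) ∈ within v (-N) 0) :
    ((A - deltaPart A : OpRing v) : Op) ∈ within v 0 0 := by
  rw [deltaPart_eq_negSum_sub hA, ← sub_add]
  exact add_mem (within_mono zero_le_one le_rfl (sub_negSum_mem_within hA)) (fn_mem_within v _)

/-- The coefficient of `(Λ ^ (-v) - 1) ^ q`, for `q ≥ 1`, when an operator on the line along `v`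
is rewritten in powers of `Λ ^ (-v) - 1`. -/
def deltaCoeff (A : OpRing v) (q : ℕ) (m : Site) : TimeField :=
  ∑ᶠ s : ℕ, (q + s).choose s • negCoeff A (q + s) m

theorem deltaCoeff_eq_sum {N : ℕ} {A : OpRing v} (hA : (A : Op) ∈ within v (-N) 0) (q : ℕ) :
    deltaCoeff A q = ∑ n ∈ Finset.range (N + 1), n.choose q • negCoeff A n := by
  have hzero : ∀ n, N < n → negCoeff A n = 0 := fun n hn => funext fun m => by
    refine eq_zero_of_mem_within hA ?_ m
    rwa [map_neg, map_nsmul, along_self, nsmul_one, neg_lt_neg_iff, Nat.cast_lt]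
  ext m
  have hsupp : (Function.support fun s : ℕ => (q + s).choose s • negCoeff A (q + s) m) ⊆
      Finset.range (N + 1 - q) := fun s hs => by
    by_contra h
    rw [Finset.mem_coe, Finset.mem_range] at h
    refine hs ?_
    simp only [hzero (q + s) (by omega), Pi.zero_apply, smul_zero]
  have hIco : Finset.Ico q (N + 1) ⊆ Finset.range (N + 1) := by
    rw [Finset.range_eq_Ico]
    exact Finset.Ico_subset_Ico_left q.zero_le
  calc deltaCoeff A q m
    _ = ∑ s ∈ Finset.range (N + 1 - q), (q + s).choose q • negCoeff A (q + s) m := by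
        rw [deltaCoeff, finsum_eq_sum_of_support_subset _ hsupp]
        simp only [← Nat.choose_symm_add]
    _ = ∑ n ∈ Finset.Ico q (N + 1), n.choose q • negCoeff A n m := by
        rw [Finset.sum_Ico_eq_sum_range]
    _ = ∑ n ∈ Finset.range (N + 1), n.choose q • negCoeff A n m := by
        refine Finset.sum_subset hIco fun n hn hnq => ?_
        rw [Finset.mem_range] at hn
        rw [Finset.mem_Ico] at hnq
        rw [Nat.choose_eq_zero_of_lt (by omega), zero_smul]
    _ = _ := by rw [Finset.sum_apply]; rfl

theorem sh_neg_nsmul_sub_one {n N : ℕ} (hn : n ≤ N) : (sh v (-(n • v)) - 1 : OpRing v) =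
    ∑ q ∈ Finset.range N, n.choose (q + 1) • (sh v (-v) - 1 : OpRing v) ^ (q + 1) := by
  have hpow : (sh v (-(n • v)) : OpRing v) =
      ∑ q ∈ Finset.range (N + 1), n.choose q • (sh v (-v) - 1 : OpRing v) ^ q := by
    have h := (Commute.one_right (sh v (-v) - 1 : OpRing v)).add_pow n
    rw [sub_add_cancel, ← sh_nsmul, smul_neg] at h
    rw [h]
    simp only [one_pow, mul_one, nsmul_eq_mul']
    refine Finset.sum_subset (Finset.range_subset_range.2 (Nat.add_le_add_right hn 1))
      fun q _ hq => ?_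
    rw [Nat.choose_eq_zero_of_lt (by simpa [Nat.lt_succ_iff] using hq), Nat.cast_zero, mul_zero]
  rw [hpow, Finset.sum_range_succ', pow_zero, Nat.choose_zero_right, one_smul, add_sub_cancel_right]

theorem deltaPart_eq_sum_pow {N : ℕ} {A : OpRing v} (hA : (A : Op) ∈ within v (-N) 0) :
    deltaPart A = ∑ q ∈ Finset.range N,
      ofFn v (deltaCoeff A (q + 1)) * (sh v (-v) - 1) ^ (q + 1) := by
  rw [deltaPart_eq_sum hA, Finset.sum_congr rfl fun n hn => by
    rw [sh_neg_nsmul_sub_one (Finset.mem_range_succ_iff.1 hn), Finset.mul_sum], Finset.sum_comm]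
  simp only [deltaCoeff_eq_sum hA, map_sum, map_nsmul, Finset.sum_mul, smul_mul_assoc,
    mul_smul_comm]

theorem finsum_fn_deltaCoeff_mul {N : ℕ} {A : OpRing v} (hA : (A : Op) ∈ within v (-N) 0) :
    ∑ᶠ q : ℕ, (if 1 ≤ q then fn (deltaCoeff A q) * (shift (-v) - 1) ^ q else 0) =
      (deltaPart A : Op) := by
  have hzero : ∀ q, N < q → deltaCoeff A q = 0 := fun q hq => by
    rw [deltaCoeff_eq_sum hA]
    refine Finset.sum_eq_zero fun n hn => ?_
    rw [Nat.choose_eq_zero_of_lt ((Finset.mem_range_succ_iff.1 hn).trans_lt hq), zero_smul]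
  have hterm : ∀ q, (if 1 ≤ q then fn (deltaCoeff A q) * (shift (-v) - 1) ^ q else 0 : Op) =
      ((if 1 ≤ q then ofFn v (deltaCoeff A q) * (sh v (-v) - 1) ^ q else 0 : OpRing v) : Op) :=
    fun q => by
      split_ifs
      · rw [coe_mul, coe_pow]
        rfl
      · rfl
  rw [finsum_congr hterm, finsum_eq_sum_of_support_subset (s := Finset.range (N + 1)),
    ← AddSubgroup.val_finsetSum, Finset.sum_range_succ', deltaPart_eq_sum_pow hA]
  · simp
  · intro q hq
    by_contra h
    rw [Finset.mem_coe, Finset.mem_range_succ_iff, not_le] at h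
    exact hq (by simp only [hzero q h, map_zero, zero_mul, ite_self, AddSubgroup.coe_zero])

theorem fn_deltaCoeff_apply (hv : v.1 = 0) {a : ℤ} {A : OpRing v} (hA : (A : Op) ∈ within v a 0)
    (q : ℕ) (j m : Site) : fn (deltaCoeff A q) j m = if j.2 = 0 then
      ∑ᶠ s : ℕ, Ring.choose ((q : ℤ) + s) s • (A : Op) (j.1, -((q + s) * v.2)) m else 0 := by
  obtain ⟨j₁, j₂⟩ := j
  by_cases h₁ : j₁ = 0
  · have hsite : ∀ n : ℕ, -(n • v) = (0, -(n * v.2)) := fun n => by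
      ext <;> simp [hv]
    simp only [fn, h₁, Prod.mk_eq_zero, true_and, deltaCoeff, negCoeff, hsite, ← Nat.cast_add,
      Ring.choose_natCast, natCast_zsmul]
  · have hline : ∀ j₂ : ℤ, (A : Op) (j₁, j₂) m = 0 := fun j₂ => by
      by_contra h₀
      have hacross := across_eq_zero_of_mem_within hA h₀
      have hnorm := along_self v
      simp only [across_apply, along_apply, hv, zero_mul, zero_add, sub_zero] at hacross hnorm
      rcases mul_eq_zero.1 hacross with h | h
      · simp [h] at hnorm
      · exact h₁ h
    simp [fn, h₁, hline]

theorem Δ₂starPart_eq_deltaPart {N : ℕ} {A : OpRing (0, 1)}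
    (hA : (A : Op) ∈ within (0, 1) (-N) 0) : Δ₂starPart A = deltaPart A := by
  have hcoeff : ∀ q : ℕ, Δ₂starCoeff A q = fn (deltaCoeff A q) := fun q => by
    ext j m
    rw [fn_deltaCoeff_apply rfl hA, Δ₂starCoeff]
    simp only [mul_one]
  simp only [Δ₂starPart, hcoeff, ← finsum_fn_deltaCoeff_mul hA]
  rfl

theorem Δ₂part_eq_deltaPart {N : ℕ} {A : OpRing (0, -1)}
    (hA : (A : Op) ∈ within (0, -1) (-N) 0) : Δ₂part A = deltaPart A := by
  have hcoeff : ∀ q : ℕ, Δ₂coeff A q = fn (deltaCoeff A q) := fun q => by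
    ext j m
    rw [fn_deltaCoeff_apply rfl hA, Δ₂coeff]
    simp only [mul_neg, mul_one, neg_neg]
  simp only [Δ₂part, hcoeff, ← finsum_fn_deltaCoeff_mul hA]
  rfl

end OpRing

/-! ### The bilinear equation to first order along the diagonal -/

section Diagonal

open MvPowerSeries TrivSqZeroExt

section Rename

variable {σ κ R : Type*} [CommRing R] (e : σ ↪ κ) [Filter.TendstoCofinite e]

theorem pderiv_rename (p : σ) (f : MvPowerSeries σ R) :
    pderiv R (e p) (rename e f) = rename e (pderiv R p f) := by
  classical
  ext d
  rw [coeff_pderiv]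
  by_cases hd : d ∈ Set.range (Finsupp.mapDomain e)
  · obtain ⟨x, rfl⟩ := hd
    rw [← Finsupp.embDomain_eq_mapDomain, ← Finsupp.embDomain_single, ← Finsupp.embDomain_add,
      coeff_embDomain_rename, coeff_embDomain_rename, coeff_pderiv, Finsupp.embDomain_apply_self]
  · rw [coeff_rename_eq_zero _ _ hd, coeff_rename_eq_zero, zero_mul]
    rw [Finsupp.mem_range_mapDomain_iff _ e.injective] at hd ⊢
    exact fun h => hd fun b hb => (add_eq_zero.1 (h b hb)).1

theorem pderiv_rename_of_notMem_range {b : κ} (hb : b ∉ Set.range e) (f : MvPowerSeries σ R) :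
    pderiv R b (rename e f) = 0 := by
  classical
  ext d
  rw [coeff_pderiv, coeff_rename_eq_zero, zero_mul, map_zero]
  rw [Finsupp.mem_range_mapDomain_iff _ e.injective]
  exact fun h => by simpa using h b hb

end Rename

instance : Filter.TendstoCofinite (Sum.elim id id : Time ⊕ Time → Time) := by
  rw [Filter.tendstoCofinite_iff_finite_preimage_singleton]
  intro p
  refine Set.Finite.subset (Set.toFinite {Sum.inl p, Sum.inr p}) ?_
  rintro (q | q) hq <;> simp_all

/-- The restriction to the diagonal `t' = t`. -/
def merge : TwoTimeSeries →ₐ[ℂ] TimeSeries := rename (Sum.elim id id)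

theorem merge_rename_inl (f : TimeSeries) : merge (rename Sum.inl f) = f := by
  rw [merge, rename_rename]
  exact rename_id_apply f

theorem merge_rename_inr (f : TimeSeries) : merge (rename Sum.inr f) = f := by
  rw [merge, rename_rename]
  exact rename_id_apply f

/-- The first-order jet `F(t, t) + ε ∂F/∂t_p (t, t)` of `F(t, t')` along the diagonal; only the
first set of times is differentiated. -/
def jet (p : Time) : TwoTimeSeries →ₐ[ℂ] DualNumber TimeSeries :=
  AlgHom.ofLinearMap
    ((inlAlgHom ℂ TimeSeries TimeSeries).toLinearMap ∘ₗ merge.toLinearMap +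
      ((inrHom TimeSeries TimeSeries).restrictScalars ℂ) ∘ₗ merge.toLinearMap ∘ₗ
        (pderiv ℂ (Sum.inl p)).toLinearMap)
    (by ext <;> simp)
    (fun F G => by ext <;> simp [Derivation.leibniz, mul_comm, add_comm])

theorem fst_jet (p : Time) (F : TwoTimeSeries) : (jet p F).fst = merge F := by
  simp [jet]

theorem snd_jet (p : Time) (F : TwoTimeSeries) :
    (jet p F).snd = merge (pderiv ℂ (Sum.inl p) F) := by
  simp [jet]

theorem jet_rename_inl (p : Time) (f : TimeSeries) :
    jet p (rename Sum.inl f) = inl f + inr (pderiv ℂ p f) := by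
  ext1
  · simp [fst_jet, merge_rename_inl]
  · rw [snd_jet]
    refine (congrArg merge (pderiv_rename Function.Embedding.inl p f)).trans ?_
    exact (merge_rename_inl _).trans (by simp)

theorem jet_rename_inr (p : Time) (f : TimeSeries) : jet p (rename Sum.inr f) = inl f := by
  ext1
  · simp [fst_jet, merge_rename_inr]
  · rw [snd_jet]
    refine (congrArg merge
      (pderiv_rename_of_notMem_range (Function.Embedding.inr (α := Time)) ?_ f)).trans ?_
    · simp
    · simp

theorem map_jet_xiDiff (p : Time) (i : Fin 3) :
    (xiDiff i).map (jet p : TwoTimeSeries →+* DualNumber TimeSeries) =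
      if i = p.1 then PowerSeries.monomial (p.2 : ℕ) DualNumber.eps else 0 := by
  have hl (q : Time) : rename Sum.inl (X q : TimeSeries) = (X (Sum.inl q) : TwoTimeSeries) :=
    rename_X _ q
  have hr (q : Time) : rename Sum.inr (X q : TimeSeries) = (X (Sum.inr q) : TwoTimeSeries) :=
    rename_X _ q
  ext1 n
  rw [PowerSeries.coeff_map, RingHom.coe_coe, apply_ite (PowerSeries.coeff n),
    PowerSeries.coeff_monomial, map_zero]
  rcases n.eq_zero_or_pos with rfl | hn
  · simp [xiDiff, p.2.pos.ne]
  · lift n to ℕ+ using hn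
    have hξ : PowerSeries.coeff n (xiDiff i) = X (Sum.inl (i, n)) - X (Sum.inr (i, n)) :=
      (PowerSeries.coeff_mk _ _).trans (dif_pos n.pos)
    have hp : (i, n) = p ↔ i = p.1 ∧ (n : ℕ) = p.2 := by rw [Prod.ext_iff, ← PNat.coe_inj]
    rw [hξ, map_sub, ← hl, ← hr, jet_rename_inl, jet_rename_inr, add_sub_cancel_left, pderiv_X,
      Pi.single_apply, ← ite_and]
    simp only [hp]
    split_ifs <;> simp

theorem jet_expXi (p : Time) (i : Fin 3) (n : ℕ) :
    jet p (expXi i n) =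
      (if n = 0 then 1 else 0) + if i = p.1 ∧ n = p.2 then DualNumber.eps else 0 := by
  set ξ : PowerSeries (DualNumber TimeSeries) :=
    if i = p.1 then PowerSeries.monomial (p.2 : ℕ) DualNumber.eps else 0 with hξ
  have hpow (r : ℕ) : jet p (PowerSeries.coeff n (xiDiff i ^ r)) = PowerSeries.coeff n (ξ ^ r) := by
    rw [hξ, ← map_jet_xiDiff, ← map_pow, PowerSeries.coeff_map, RingHom.coe_coe]
  have hsq (r : ℕ) : ξ ^ (r + 1 + 1) = 0 := by
    rw [pow_add, pow_add, mul_assoc, ← pow_two, pow_one, hξ]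
    split_ifs <;> simp [pow_two, PowerSeries.monomial_mul_monomial]
  have hcoeff : PowerSeries.coeff n ξ = if i = p.1 ∧ n = p.2 then DualNumber.eps else 0 := by
    rw [hξ, apply_ite (PowerSeries.coeff n), PowerSeries.coeff_monomial, map_zero, ite_and]
  rw [expXi, map_sum]
  simp only [map_smul, hpow]
  rcases n with _ | n
  · have hp : ¬ (i = p.1 ∧ 0 = (p.2 : ℕ)) := fun h => p.2.pos.ne h.2
    simp [hp]
  · simp [Finset.sum_range_succ', hsq, hcoeff, PowerSeries.coeff_one]

section Weight

variable {σ κ R : Type*} [CommRing R] (w : σ → ℕ)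

/-- The ideal of the power series all of whose monomials have weight at least `n`, the variable
`s` having weight `w s`. -/
def weightIdeal (n : ℕ) : Ideal (MvPowerSeries σ R) where
  carrier := {F | (n : ℕ∞) ≤ F.weightedOrder w}
  zero_mem' := by simp
  add_mem' hF hG := (le_min hF hG).trans (min_weightedOrder_le_add w)
  smul_mem' _ _ hF := (le_add_left hF).trans (le_weightedOrder_mul w)

variable {w}

theorem mem_weightIdeal {n : ℕ} {F : MvPowerSeries σ R} :
    F ∈ weightIdeal w n ↔ ∀ d, Finsupp.weight w d < n → coeff d F = 0 :=
  ⟨fun h _ hd => coeff_eq_zero_of_lt_weightedOrder w ((Nat.cast_lt.2 hd).trans_le h),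
    nat_le_weightedOrder w⟩

theorem weightIdeal_antitone : Antitone (weightIdeal w : ℕ → Ideal (MvPowerSeries σ R)) :=
  fun _ _ h _ hF => mem_weightIdeal.2 fun d hd => mem_weightIdeal.1 hF d (hd.trans_le h)

theorem mul_mem_weightIdeal {n k : ℕ} {F G : MvPowerSeries σ R} (hF : F ∈ weightIdeal w n)
    (hG : G ∈ weightIdeal w k) : F * G ∈ weightIdeal w (n + k) :=
  (by push_cast; exact add_le_add hF hG : ((n + k : ℕ) : ℕ∞) ≤ _).trans (le_weightedOrder_mul w)

theorem X_mem_weightIdeal (s : σ) : (X s : MvPowerSeries σ R) ∈ weightIdeal w (w s) := by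
  classical
  refine mem_weightIdeal.2 fun d hd => ?_
  rw [coeff_X, if_neg]
  rintro rfl
  simp [Finsupp.weight_single] at hd

theorem rename_mem_weightIdeal {f : κ → σ} [Filter.TendstoCofinite f] {n : ℕ}
    {F : MvPowerSeries κ R} (hF : F ∈ weightIdeal (w ∘ f) n) : rename f F ∈ weightIdeal w n := by
  refine mem_weightIdeal.2 fun d hd => ?_
  rw [coeff_rename]
  refine Finset.sum_eq_zero fun x hx => mem_weightIdeal.1 hF x ?_
  rw [Set.Finite.mem_toFinset, Set.mem_preimage, Set.mem_singleton_iff] at hx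
  rw [← hx] at hd
  exact (Finsupp.linearCombination_mapDomain ℕ f x).ge.trans_lt hd

theorem pderiv_mem_weightIdeal {s : σ} {n : ℕ} {F : MvPowerSeries σ R}
    (hF : F ∈ weightIdeal w (n + w s)) : pderiv R s F ∈ weightIdeal w n := by
  refine mem_weightIdeal.2 fun d hd => ?_
  rw [coeff_pderiv, mem_weightIdeal.1 hF, zero_mul]
  rw [map_add, Finsupp.weight_single, one_smul]
  exact Nat.add_lt_add_right hd _

end Weight

/-- The times `t_k` and `t'_k` have weight `k`, so that `ξ(t - t', z)` is homogeneous for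
`z` of weight `-1`. -/
def twoTimeWeight : Time ⊕ Time → ℕ := (fun p : Time => (p.2 : ℕ)) ∘ Sum.elim id id

theorem coeff_xiDiff_pow_mem_weightIdeal (i : Fin 3) (r n : ℕ) :
    PowerSeries.coeff n (xiDiff i ^ r) ∈ weightIdeal twoTimeWeight n := by
  induction r generalizing n with
  | zero =>
    rcases n.eq_zero_or_pos with rfl | hn
    · exact mem_weightIdeal.2 fun d hd => absurd hd (by omega)
    · rw [pow_zero, PowerSeries.coeff_one, if_neg hn.ne']
      exact zero_mem _
  | succ r ih =>
    rw [pow_succ, PowerSeries.coeff_mul]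
    refine sum_mem fun x hx => ?_
    rw [← Finset.HasAntidiagonal.mem_antidiagonal.1 hx]
    refine mul_mem_weightIdeal (ih x.1) ?_
    rw [xiDiff, PowerSeries.coeff_mk]
    split_ifs with hx
    · exact sub_mem (X_mem_weightIdeal (w := twoTimeWeight) (Sum.inl (i, ⟨x.2, hx⟩)))
        (X_mem_weightIdeal (w := twoTimeWeight) (Sum.inr (i, ⟨x.2, hx⟩)))
    · exact zero_mem _

theorem expXi_mem_weightIdeal (i : Fin 3) (n : ℕ) : expXi i n ∈ weightIdeal twoTimeWeight n :=
  sum_mem fun r _ => Submodule.smul_of_tower_mem _ _ (coeff_xiDiff_pow_mem_weightIdeal i r n)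

/-- The series `∑ₙ eₙ Fₙ`, where `exp (ξ(t^{(i)} - t'^{(i)}, z)) = ∑ₙ eₙ z ^ n`; both kinds of
residues in the bilinear equation have this form. -/
def expSum (i : Fin 3) (F : ℕ → TwoTimeSeries) : TwoTimeSeries :=
  fun d => ∑ᶠ n : ℕ, coeff d (expXi i n * F n)

theorem expSum_sub_sum_mem_weightIdeal (i : Fin 3) (F : ℕ → TwoTimeSeries) (N : ℕ) :
    expSum i F - ∑ n ∈ Finset.range N, expXi i n * F n ∈ weightIdeal twoTimeWeight N := by
  refine mem_weightIdeal.2 fun d hd => ?_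
  rw [map_sub, map_sum, sub_eq_zero]
  refine finsum_eq_sum_of_support_subset _ fun n hn => Finset.mem_coe.2 (Finset.mem_range.2 ?_)
  by_contra! h
  exact hn (mem_weightIdeal.1 (Ideal.mul_mem_right (F n) _ (expXi_mem_weightIdeal i n)) d
    (hd.trans_le h))

theorem jet_eq_of_sub_mem_weightIdeal (p : Time) {F : TwoTimeSeries} {x : DualNumber TimeSeries}
    {G : ℕ → TwoTimeSeries} (hG : ∀ N, F - G N ∈ weightIdeal twoTimeWeight N)
    {N₀ : ℕ} (hx : ∀ N ≥ N₀, jet p (G N) = x) : jet p F = x := by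
  have key (N : ℕ) : (jet p F - x).fst ∈ weightIdeal (fun p : Time => (p.2 : ℕ)) N ∧
      (jet p F - x).snd ∈ weightIdeal (fun p : Time => (p.2 : ℕ)) N := by
    rw [← hx (max N₀ (N + p.2)) (le_max_left _ _), ← map_sub, fst_jet, snd_jet]
    have h := hG (max N₀ (N + p.2))
    exact ⟨rename_mem_weightIdeal (weightIdeal_antitone (by omega) h),
      rename_mem_weightIdeal (pderiv_mem_weightIdeal (s := Sum.inl p)
        (weightIdeal_antitone (le_max_right _ _) h))⟩
  rw [← sub_eq_zero]
  ext d
  · exact mem_weightIdeal.1 (key _).1 d (Nat.lt_succ_self _)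
  · exact mem_weightIdeal.1 (key _).2 d (Nat.lt_succ_self _)

theorem jet_expSum (p : Time) (i : Fin 3) (F : ℕ → TwoTimeSeries) :
    jet p (expSum i F) =
      jet p (F 0) + if i = p.1 then DualNumber.eps * jet p (F p.2) else 0 := by
  refine jet_eq_of_sub_mem_weightIdeal p (expSum_sub_sum_mem_weightIdeal i F) (N₀ := p.2 + 1)
    fun N hN => ?_
  rw [map_sum]
  simp only [map_mul, jet_expXi, add_mul, Finset.sum_add_distrib, ite_mul, one_mul, zero_mul]
  rw [Finset.sum_ite_eq', if_pos (Finset.mem_range.2 (by omega))]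
  simp only [ite_and]
  split_ifs
  · rw [Finset.sum_ite_eq', if_pos (Finset.mem_range.2 (by omega))]
  · rw [Finset.sum_const_zero]

end Diagonal

/-- A power series in the spectral parameter, with coefficients viewed as quotients. -/
def toLaurent : PowerSeries TimeSeries →+* LaurentSeries TimeField :=
  (HahnSeries.ofPowerSeries ℤ TimeField).comp (PowerSeries.map (algebraMap TimeSeries TimeField))

theorem coeff_toLaurent_natCast (F : PowerSeries TimeSeries) (n : ℕ) :
    (toLaurent F).coeff n = tauQ (PowerSeries.coeff n F) := by
  rw [toLaurent, RingHom.comp_apply, HahnSeries.ofPowerSeries_apply_coeff, PowerSeries.coeff_map,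
    tauQ]

theorem coeff_toLaurent_of_neg (F : PowerSeries TimeSeries) {n : ℤ} (hn : n < 0) :
    (toLaurent F).coeff n = 0 := by
  rw [toLaurent, RingHom.comp_apply, HahnSeries.ofPowerSeries_apply]
  refine HahnSeries.embDomain_of_notMem_range ?_
  rintro ⟨k, rfl⟩
  exact hn.not_ge (Int.natCast_nonneg k)

/-- `f (t + c [z]_i)`, as a series in `z`. -/
def shiftSeries (i : Fin 3) (c : ℂ) (f : TimeSeries) : PowerSeries TimeSeries :=
  PowerSeries.mk (shiftCoeff i c f)

/-- The operator that `∂/∂t_k^{(j)}`, `p = (j, k)`, induces on series in the spectral parameter `x`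
multiplied by `exp (ξ(t^{(i)}, x⁻¹))`. -/
def waveDeriv (p : Time) (i : Fin 3) : LaurentSeries TimeField →+ LaurentSeries TimeField :=
  AddMonoidHom.mk'
    (fun W => W.map (timeDerivation p) +
      if i = p.1 then HahnSeries.single (-(p.2 : ℤ)) 1 * W else 0)
    (fun V W => by
      ext n
      split_ifs <;> simp [mul_add, add_add_add_comm])

theorem coeff_waveDeriv (p : Time) (i : Fin 3) (W : LaurentSeries TimeField) (n : ℤ) :
    (waveDeriv p i W).coeff n =
      timeDeriv p (W.coeff n) + if i = p.1 then W.coeff (n + p.2) else 0 := by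
  simp only [waveDeriv, AddMonoidHom.mk'_apply, HahnSeries.coeff_add, HahnSeries.map_coeff,
    timeDerivation_apply]
  split_ifs <;> simp [HahnSeries.coeff_single_mul]

theorem waveDeriv_smul (p : Time) (i : Fin 3) (c : TimeField) (W : LaurentSeries TimeField) :
    waveDeriv p i (c • W) = c • waveDeriv p i W + timeDeriv p c • W := by
  ext n
  simp only [coeff_waveDeriv, HahnSeries.coeff_add, HahnSeries.coeff_smul, smul_eq_mul,
    timeDeriv_mul]
  split_ifs <;> ring

theorem waveDeriv_single_mul (p : Time) (i : Fin 3) (o : ℤ) {s : TimeField}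
    (hs : timeDeriv p s = 0) (W : LaurentSeries TimeField) :
    waveDeriv p i (HahnSeries.single o s * W) = HahnSeries.single o s * waveDeriv p i W := by
  ext n
  simp only [coeff_waveDeriv, HahnSeries.coeff_single_mul, timeDeriv_mul, hs]
  rw [add_sub_right_comm]
  split_ifs <;> ring

theorem tauQ_fst_jet_pairCoeff (p : Time) (i : Fin 3) (f g : TimeSeries) (l : ℤ) :
    tauQ (jet p (pairCoeff i f g l)).fst =
      (toLaurent (shiftSeries i (-1) f) * toLaurent (shiftSeries i 1 g)).coeff l := by
  rw [← map_mul]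
  rcases lt_or_ge l 0 with hl | hl
  · rw [coeff_toLaurent_of_neg _ hl, pairCoeff, if_neg hl.not_ge]
    simp [tauQ]
  · lift l to ℕ using hl
    rw [coeff_toLaurent_natCast, pairCoeff, if_pos l.cast_nonneg, PowerSeries.coeff_mul, fst_jet,
      map_sum]
    simp [merge_rename_inl, merge_rename_inr, shiftSeries]

theorem tauQ_snd_jet_pairCoeff (p : Time) (i : Fin 3) (f g : TimeSeries) (l : ℤ) :
    tauQ (jet p (pairCoeff i f g l)).snd =
      ((toLaurent (shiftSeries i (-1) f)).map (timeDerivation p) *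
        toLaurent (shiftSeries i 1 g)).coeff l := by
  have hmap : (toLaurent (shiftSeries i (-1) f)).map (timeDerivation p) =
      toLaurent (PowerSeries.mk fun n => MvPowerSeries.pderiv ℂ p (shiftCoeff i (-1) f n)) := by
    ext n
    rw [HahnSeries.map_coeff]
    rcases lt_or_ge n 0 with hn | hn
    · rw [coeff_toLaurent_of_neg _ hn, coeff_toLaurent_of_neg _ hn, map_zero]
    · lift n to ℕ using hn
      rw [coeff_toLaurent_natCast, coeff_toLaurent_natCast, timeDerivation_tauQ, shiftSeries,
        PowerSeries.coeff_mk, PowerSeries.coeff_mk]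
  rw [hmap, ← map_mul]
  rcases lt_or_ge l 0 with hl | hl
  · rw [coeff_toLaurent_of_neg _ hl, pairCoeff, if_neg hl.not_ge]
    simp [tauQ]
  · lift l to ℕ using hl
    rw [coeff_toLaurent_natCast, pairCoeff, if_pos l.cast_nonneg, PowerSeries.coeff_mul, map_sum,
      TrivSqZeroExt.snd_sum]
    simp [jet_rename_inl, jet_rename_inr, shiftSeries]

theorem tauQ_fst_jet_expSum (p : Time) (i : Fin 3) (f g : TimeSeries) (l : ℤ) :
    tauQ (jet p (expSum i fun n => pairCoeff i f g (n + l))).fst =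
      (toLaurent (shiftSeries i (-1) f) * toLaurent (shiftSeries i 1 g)).coeff l := by
  rw [jet_expSum, Nat.cast_zero, zero_add, ← tauQ_fst_jet_pairCoeff p]
  split_ifs <;> simp

theorem tauQ_snd_jet_expSum (p : Time) (i : Fin 3) (f g : TimeSeries) (l : ℤ) :
    tauQ (jet p (expSum i fun n => pairCoeff i f g (n + l))).snd =
      (waveDeriv p i (toLaurent (shiftSeries i (-1) f)) *
        toLaurent (shiftSeries i 1 g)).coeff l := by
  have hshift : (HahnSeries.single (-(p.2 : ℤ)) 1 * toLaurent (shiftSeries i (-1) f) *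
      toLaurent (shiftSeries i 1 g)).coeff l = tauQ (jet p (pairCoeff i f g (p.2 + l))).fst := by
    rw [tauQ_fst_jet_pairCoeff, mul_assoc, HahnSeries.coeff_single_mul, one_mul, sub_neg_eq_add,
      add_comm l]
  rw [jet_expSum, Nat.cast_zero, zero_add, waveDeriv, AddMonoidHom.mk'_apply, add_mul,
    HahnSeries.coeff_add, ← tauQ_snd_jet_pairCoeff, ite_mul, zero_mul,
    TrivSqZeroExt.snd_add, tauQ, map_add]
  split_ifs
  · simp [hshift, tauQ]
  · simp [tauQ]

theorem hasSubst_shiftVar (i : Fin 3) (c : ℂ) : MvPowerSeries.HasSubst (shiftVar i c) := by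
  classical
  refine ⟨fun p => ?_, fun d => ?_⟩
  · have : MvPowerSeries.constantCoeff (shiftVar i c p) = 0 := by
      unfold shiftVar
      split_ifs <;> simp
    rw [this]
    exact IsNilpotent.zero
  · have hX : {p : Time | d = Finsupp.single (some p) 1}.Finite :=
      Set.Subsingleton.finite fun p hp q hq => by
        simpa [Finsupp.single_left_inj] using hp.symm.trans hq
    have hz : {p : Time | p.1 = i ∧ d = Finsupp.single none (p.2 : ℕ)}.Finite :=
      Set.Subsingleton.finite fun p hp q hq => Prod.ext (hp.1.trans hq.1.symm) <|
        PNat.coe_injective <| Finsupp.single_injective _ (hp.2.symm.trans hq.2)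
    refine (hX.union hz).subset fun p hp => ?_
    by_contra hn
    rw [Set.mem_union, not_or] at hn
    refine hp ?_
    rw [shiftVar, map_add, MvPowerSeries.coeff_X, if_neg (by exact hn.1), zero_add]
    split_ifs with h
    · rw [MvPowerSeries.coeff_C_mul, MvPowerSeries.coeff_X_pow, if_neg fun h' => hn.2 ⟨h, h'⟩,
        mul_zero]
    · exact map_zero _

theorem killCompl_shiftVar (i : Fin 3) (c : ℂ) (p : Time) :
    MvPowerSeries.killCompl (Function.Embedding.some : Time ↪ Option Time) (shiftVar i c p) =
      MvPowerSeries.X p := by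
  have hX : MvPowerSeries.killCompl (Function.Embedding.some : Time ↪ Option Time)
      (MvPowerSeries.X (R := ℂ) (some p)) = MvPowerSeries.X p := MvPowerSeries.killCompl_X p
  have hz : MvPowerSeries.killCompl (Function.Embedding.some : Time ↪ Option Time)
      (MvPowerSeries.X (R := ℂ) none) = 0 := MvPowerSeries.killCompl_X_eq_zero (by simp)
  rw [shiftVar, map_add, hX, add_eq_left]
  split_ifs
  · rw [map_mul, map_pow, hz, zero_pow p.2.ne_zero, mul_zero]
  · exact map_zero _

theorem shiftCoeff_zero (i : Fin 3) (c : ℂ) (f : TimeSeries) : shiftCoeff i c f 0 = f := by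
  classical
  let e : Time ↪ Option Time := Function.Embedding.some
  have hmon (a : Time →₀ ℕ) :
      MvPowerSeries.killCompl e (a.prod fun p n => shiftVar i c p ^ n) =
        MvPowerSeries.monomial a 1 := by
    rw [Finsupp.prod, map_prod, MvPowerSeries.monomial_one_eq]
    exact Finset.prod_congr rfl fun p _ => by rw [map_pow, killCompl_shiftVar]
  ext d
  have hcoeff : MvPowerSeries.coeff d (shiftCoeff i c f 0) =
      MvPowerSeries.coeff (d.embDomain e) (MvPowerSeries.subst (shiftVar i c) f) := by
    rw [Finsupp.embDomain_eq_mapDomain, ← add_zero (d.mapDomain e), ← Finsupp.single_zero none]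
    rfl
  rw [hcoeff, MvPowerSeries.coeff_subst (hasSubst_shiftVar i c), finsum_eq_single _ d]
  · rw [← MvPowerSeries.coeff_killCompl, hmon, MvPowerSeries.coeff_monomial_same, smul_eq_mul,
      mul_one]
  · intro a ha
    rw [← MvPowerSeries.coeff_killCompl, hmon, MvPowerSeries.coeff_monomial_ne ha.symm, smul_zero]

section Laurent

variable {K : Type*} [Semiring K]

theorem coeff_laurent_mul_eq_zero {f g : LaurentSeries K} {a b n : ℤ}
    (hf : ∀ j < a, f.coeff j = 0) (hg : ∀ j < b, g.coeff j = 0) (hn : n < a + b) :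
    (f * g).coeff n = 0 := by
  rw [HahnSeries.coeff_mul]
  refine Finset.sum_eq_zero fun q hq => ?_
  have hsum := (Finset.mem_antidiagonal.1 hq).2.2
  rcases lt_or_ge q.1 a with h | h
  · rw [hf _ h, zero_mul]
  · rw [hg _ (by omega), mul_zero]

theorem coeff_laurent_mul_add {f g : LaurentSeries K} {a b : ℤ}
    (hf : ∀ j < a, f.coeff j = 0) (hg : ∀ j < b, g.coeff j = 0) :
    (f * g).coeff (a + b) = f.coeff a * g.coeff b := by
  rw [HahnSeries.coeff_mul]
  refine Finset.sum_eq_single (a, b) (fun q hq hne => ?_) fun hab => ?_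
  · have hsum := (Finset.mem_antidiagonal.1 hq).2.2
    rcases lt_or_ge q.1 a with h | h
    · rw [hf _ h, zero_mul]
    · have hb : q.2 ≠ b := fun hb => hne (Prod.ext (by simp only; omega) hb)
      rw [hg _ (by omega), mul_zero]
  · by_contra h
    exact hab (Finset.mem_antidiagonal.2
      ⟨left_ne_zero_of_mul h, right_ne_zero_of_mul h, rfl⟩)

end Laurent

/-- The component `i` of the wave function at `m` has numerator `τ_{m + waveShift i}`. -/
def waveShift : Fin 3 → Site := ![0, (1, 1), (1, 0)]

/-- The exponent of the leading power of the spectral parameter in component `i` of the wave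
function; the parameter of component `0` is `z⁻¹`, that of the other ones `z`. -/
def waveOrd : Fin 3 → Site →+ ℤ :=
  ![-AddMonoidHom.fst ℤ ℤ, AddMonoidHom.snd ℤ ℤ, AddMonoidHom.fst ℤ ℤ - AddMonoidHom.snd ℤ ℤ]

/-- The sign of component `i` of the wave function at `m`. -/
def waveSign (m : Site) : Fin 3 → TimeField := ![1, 1, (-1) ^ m.2]

theorem waveSign_ne_zero (m : Site) (i : Fin 3) : waveSign m i ≠ 0 := by
  fin_cases i <;> simp [waveSign, zpow_ne_zero]

theorem timeDeriv_waveSign (p : Time) (m : Site) (i : Fin 3) : timeDeriv p (waveSign m i) = 0 := by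
  rw [← timeDerivation_apply]
  fin_cases i
  · simp [waveSign]
  · simp [waveSign]
  · rcases Int.even_or_odd m.2 with h | h <;> simp [waveSign, h.neg_one_zpow]

/-- The wave function at `m`, without its exponential factor, times `τ_m`. -/
def tauWave (τ : Site → TimeSeries) (m : Site) (i : Fin 3) : LaurentSeries TimeField :=
  HahnSeries.single (waveOrd i m) (waveSign m i) *
    toLaurent (shiftSeries i (-1) (τ (m + waveShift i)))

/-- The dual wave function at `m`, without its exponential factor, times `τ_m`. -/
def dualTauWave (τ : Site → TimeSeries) (m : Site) (i : Fin 3) : LaurentSeries TimeField :=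
  HahnSeries.single (-waveOrd i m) (waveSign m i) *
    toLaurent (shiftSeries i 1 (τ (m - waveShift i)))

/-- The wave function at `m`, without its exponential factor. -/
def wave (τ : Site → TimeSeries) (m : Site) (i : Fin 3) : LaurentSeries TimeField :=
  (tauQ (τ m))⁻¹ • tauWave τ m i

/-- The exponent at which the bilinear equation takes the coefficient in component `i`: the residue
in `z`, in terms of the spectral parameter of that component. -/
def resOrd : Fin 3 → ℤ := ![1, -1, -1]

/-- The series which satisfy the bilinear equation at equal times with all dual wave functions. -/
def bilinear (τ : Site → TimeSeries) : Submodule TimeField (Fin 3 → LaurentSeries TimeField) where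
  carrier := {W | ∀ m, (W 0 * dualTauWave τ m 0).coeff (resOrd 0) =
    (W 1 * dualTauWave τ m 1).coeff (resOrd 1) + (W 2 * dualTauWave τ m 2).coeff (resOrd 2)}
  zero_mem' m := by simp
  add_mem' {V W} hV hW m := by
    simp only [Pi.add_apply, add_mul, HahnSeries.coeff_add]
    rw [hV m, hW m, add_add_add_comm]
  smul_mem' c W hW m := by
    simp only [Pi.smul_apply, ← HahnSeries.C_mul_eq_smul, mul_assoc, HahnSeries.C_apply,
      HahnSeries.coeff_single_zero_mul]
    rw [hW m, mul_add]

theorem coeff_single_mul_mul_single_mul (o o' e : ℤ) (s s' : TimeField)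
    (F G : LaurentSeries TimeField) :
    (HahnSeries.single o s * F * (HahnSeries.single (-o') s' * G)).coeff e =
      s * s' * (F * G).coeff (e - o + o') := by
  rw [mul_mul_mul_comm, HahnSeries.single_mul_single, HahnSeries.coeff_single_mul]
  congr 2
  ring

theorem single_mul_mem_bilinear_iff {τ : Site → TimeSeries} {m : Site}
    {F : Fin 3 → LaurentSeries TimeField} :
    (fun i => HahnSeries.single (waveOrd i m) (waveSign m i) * F i) ∈ bilinear τ ↔ ∀ m' : Site,
      (F 0 * toLaurent (shiftSeries 0 1 (τ m'))).coeff (m.1 - m'.1 + 1) =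
        (F 1 * toLaurent (shiftSeries 1 1 (τ (m' - (1, 1))))).coeff (-(m.2 - m'.2) - 1) +
        (-1) ^ (m.2 + m'.2) * (F 2 * toLaurent (shiftSeries 2 1 (τ (m' - (1, 0))))).coeff
          (-(m.1 - m.2 - m'.1 + m'.2) - 1) := by
  refine forall_congr' fun m' => ?_
  simp only [dualTauWave, coeff_single_mul_mul_single_mul, waveOrd, waveSign, waveShift, resOrd,
    Matrix.cons_val, AddMonoidHom.neg_apply, AddMonoidHom.sub_apply, AddMonoidHom.coe_fst,
    AddMonoidHom.coe_snd, sub_zero, one_mul]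
  rw [zpow_add₀ (neg_ne_zero.2 one_ne_zero)]
  ring_nf

theorem resInfty_eq_expSum (i : Fin 3) (a : ℤ) (f g : TimeSeries) :
    resInfty i a f g = expSum i fun n => pairCoeff i f g (n + (a + 1)) := by
  simp only [← add_assoc]
  rfl

theorem resZero_eq_expSum (i : Fin 3) (a : ℤ) (f g : TimeSeries) :
    resZero i a f g = expSum i fun n => pairCoeff i f g (n + (-a - 1)) := by
  simp only [← add_sub_assoc, ← sub_eq_add_neg]
  rfl

theorem jet_bilinear {τ : Site → TimeSeries} (hKP : IsThreeKPTau τ) (p : Time) (m m' : Site) :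
    jet p (expSum 0 fun n => pairCoeff 0 (τ m) (τ m') (n + (m.1 - m'.1 + 1))) =
      jet p (expSum 1 fun n => pairCoeff 1 (τ (m + (1, 1))) (τ (m' - (1, 1)))
        (n + (-(m.2 - m'.2) - 1))) +
      (-1 : ℂ) ^ (m.2 + m'.2) • jet p (expSum 2 fun n =>
        pairCoeff 2 (τ (m + (1, 0))) (τ (m' - (1, 0))) (n + (-(m.1 - m.2 - m'.1 + m'.2) - 1))) := by
  rw [← resInfty_eq_expSum, ← resZero_eq_expSum, ← resZero_eq_expSum, hKP m m', map_add, map_smul]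

theorem tauQ_add_neg_one_zpow_smul (n : ℤ) (f g : TimeSeries) :
    tauQ (f + (-1 : ℂ) ^ n • g) = tauQ f + (-1) ^ n * tauQ g := by
  rcases Int.even_or_odd n with h | h <;> simp [h.neg_one_zpow, tauQ]

theorem tauWave_mem_bilinear {τ : Site → TimeSeries} (hKP : IsThreeKPTau τ) (m : Site) :
    tauWave τ m ∈ bilinear τ := by
  refine single_mul_mem_bilinear_iff.2 fun m' => ?_
  have h := congrArg (fun x => tauQ x.fst) (jet_bilinear hKP (0, 1) m m')
  simpa only [TrivSqZeroExt.fst_add, TrivSqZeroExt.fst_smul, tauQ_add_neg_one_zpow_smul,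
    tauQ_fst_jet_expSum, waveShift, Matrix.cons_val, add_zero] using h

theorem waveDeriv_tauWave_mem_bilinear {τ : Site → TimeSeries} (hKP : IsThreeKPTau τ) (p : Time)
    (m : Site) : (fun i => waveDeriv p i (tauWave τ m i)) ∈ bilinear τ := by
  simp only [tauWave, waveDeriv_single_mul p _ _ (timeDeriv_waveSign p m _)]
  refine single_mul_mem_bilinear_iff.2 fun m' => ?_
  have h := congrArg (fun x => tauQ x.snd) (jet_bilinear hKP p m m')
  simpa only [TrivSqZeroExt.snd_add, TrivSqZeroExt.snd_smul, tauQ_add_neg_one_zpow_smul,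
    tauQ_snd_jet_expSum, waveShift, Matrix.cons_val, add_zero] using h

theorem wave_mem_bilinear {τ : Site → TimeSeries} (hKP : IsThreeKPTau τ) (m : Site) :
    wave τ m ∈ bilinear τ :=
  Submodule.smul_mem _ _ (tauWave_mem_bilinear hKP m)

theorem waveDeriv_wave_mem_bilinear {τ : Site → TimeSeries} (hKP : IsThreeKPTau τ) (p : Time)
    (m : Site) : (fun i => waveDeriv p i (wave τ m i)) ∈ bilinear τ := by
  simp only [wave, waveDeriv_smul]
  exact add_mem (Submodule.smul_mem _ _ (waveDeriv_tauWave_mem_bilinear hKP p m))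
    (Submodule.smul_mem _ _ (tauWave_mem_bilinear hKP m))

theorem coeff_single_mul_toLaurent (o : ℤ) (s : TimeField) (F : PowerSeries TimeSeries) (n : ℕ) :
    (HahnSeries.single o s * toLaurent F).coeff (n + o) = s * tauQ (PowerSeries.coeff n F) := by
  rw [HahnSeries.coeff_single_mul, add_sub_cancel_right, coeff_toLaurent_natCast]

theorem coeff_single_mul_toLaurent_of_lt {o n : ℤ} (hn : n < o) (s : TimeField)
    (F : PowerSeries TimeSeries) : (HahnSeries.single o s * toLaurent F).coeff n = 0 := by
  rw [HahnSeries.coeff_single_mul, coeff_toLaurent_of_neg _ (sub_neg.2 hn), mul_zero]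

theorem coeff_dualTauWave_neg_waveOrd_ne_zero {τ : Site → TimeSeries} (hτ : ∀ m, τ m ≠ 0)
    (m : Site) (i : Fin 3) : (dualTauWave τ m i).coeff (-waveOrd i m) ≠ 0 := by
  have h := coeff_single_mul_toLaurent (-waveOrd i m) (waveSign m i)
    (shiftSeries i 1 (τ (m - waveShift i))) 0
  rw [shiftSeries, PowerSeries.coeff_mk, shiftCoeff_zero, Nat.cast_zero, zero_add] at h
  exact h.trans_ne (mul_ne_zero (waveSign_ne_zero m i) (tauQ_ne_zero (hτ _)))

theorem coeff_wave (τ : Site → TimeSeries) (m : Site) (i : Fin 3) (n : ℕ) :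
    (wave τ m i).coeff (n + waveOrd i m) =
      waveSign m i * tauQ (shiftCoeff i (-1) (τ (m + waveShift i)) n) / tauQ (τ m) := by
  rw [wave, HahnSeries.coeff_smul, tauWave, coeff_single_mul_toLaurent, shiftSeries,
    PowerSeries.coeff_mk, smul_eq_mul, inv_mul_eq_div]

theorem coeff_wave_of_lt (τ : Site → TimeSeries) {m : Site} {i : Fin 3} {n : ℤ}
    (hn : n < waveOrd i m) : (wave τ m i).coeff n = 0 := by
  rw [wave, HahnSeries.coeff_smul, tauWave, coeff_single_mul_toLaurent_of_lt hn, smul_zero]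

theorem coeff_wave_waveOrd (τ : Site → TimeSeries) (m : Site) (i : Fin 3) :
    (wave τ m i).coeff (waveOrd i m) =
      waveSign m i * tauQ (τ (m + waveShift i)) / tauQ (τ m) := by
  simpa only [Nat.cast_zero, zero_add, shiftCoeff_zero] using coeff_wave τ m i 0

theorem coeff_wave_zero_waveOrd {τ : Site → TimeSeries} (hτ : ∀ m, τ m ≠ 0) (m : Site) :
    (wave τ m 0).coeff (waveOrd 0 m) = 1 := by
  rw [coeff_wave_waveOrd, waveSign, waveShift, Matrix.cons_val_zero, Matrix.cons_val_zero, one_mul,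
    add_zero, div_self (tauQ_ne_zero (hτ m))]

/-- At equal times the bilinear equation pairs the leading coefficients of `W i` and of the dual
wave function, all other terms being of higher order. -/
theorem coeff_eq_zero_of_mem_bilinear {τ : Site → TimeSeries} (hτ : ∀ m, τ m ≠ 0)
    {W : Fin 3 → LaurentSeries TimeField} (hW : W ∈ bilinear τ) (i : Fin 3) (m : Site)
    (hlow : ∀ i', ∀ n < waveOrd i' m + resOrd i' + (if i' = i then 0 else 1),
      (W i').coeff n = 0) : (W i).coeff (waveOrd i m + resOrd i) = 0 := by
  have hdual (i' : Fin 3) : ∀ n < -waveOrd i' m, (dualTauWave τ m i').coeff n = 0 := fun n hn =>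
    coeff_single_mul_toLaurent_of_lt hn _ _
  have hother (i' : Fin 3) (hi' : i' ≠ i) : (W i' * dualTauWave τ m i').coeff (resOrd i') = 0 := by
    refine coeff_laurent_mul_eq_zero (hlow i') (hdual i') ?_
    rw [if_neg hi']
    omega
  have hlead : (W i * dualTauWave τ m i).coeff (resOrd i) =
      (W i).coeff (waveOrd i m + resOrd i) * (dualTauWave τ m i).coeff (-waveOrd i m) := by
    rw [← coeff_laurent_mul_add (by simpa using hlow i) (hdual i)]
    congr 1
    ring
  have hres : (W i * dualTauWave τ m i).coeff (resOrd i) = 0 := by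
    have h := hW m
    fin_cases i
    · exact h.trans (by rw [hother 1 (by decide), hother 2 (by decide), add_zero])
    · simpa [hother 0, hother 2] using h.symm
    · simpa [hother 0, hother 1] using h.symm
  exact (mul_eq_zero.1 (hlead.symm.trans hres)).resolve_right
    (coeff_dualTauWave_neg_waveOrd_ne_zero hτ m i)

theorem eq_zero_of_mem_bilinear {τ : Site → TimeSeries} (hτ : ∀ m, τ m ≠ 0)
    {W : Fin 3 → LaurentSeries TimeField} (hW : W ∈ bilinear τ) (m : Site)
    (hlow : ∀ i, ∀ n < waveOrd i m + (if i = 0 then 1 else 0), (W i).coeff n = 0) : W = 0 := by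
  funext i
  by_contra hne
  set n := (W i).order with hn
  have hcoeff : (W i).coeff n ≠ 0 := fun h => hne (HahnSeries.coeff_order_eq_zero.1 h)
  have hbelow : ∀ j < n, (W i).coeff j = 0 := fun j => HahnSeries.coeff_eq_zero_of_lt_order
  have hle : waveOrd i m + (if i = 0 then 1 else 0) ≤ n := le_of_not_gt fun h => hcoeff (hlow i n h)
  obtain ⟨m', hm', hm''⟩ : ∃ m' : Site, waveOrd i m' + resOrd i = n ∧
      ∀ i', i' ≠ i → waveOrd i' m' + resOrd i' + 1 ≤ waveOrd i' m + if i' = 0 then 1 else 0 := by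
    fin_cases i
    · refine ⟨(1 - n, m.2), ?_, fun i' hi' => ?_⟩
      · simp [waveOrd, resOrd]
      · fin_cases i' <;> simp_all [waveOrd, resOrd]
        omega
    · refine ⟨(m.1 + 1, n + 1), ?_, fun i' hi' => ?_⟩
      · simp [waveOrd, resOrd]
      · fin_cases i' <;> simp_all [waveOrd, resOrd]
        omega
    · refine ⟨(n + 1 + m.2, m.2), ?_, fun i' hi' => ?_⟩
      · simp [waveOrd, resOrd]
      · fin_cases i' <;> simp_all [waveOrd, resOrd]
        omega
  refine hcoeff (hm' ▸ coeff_eq_zero_of_mem_bilinear hτ hW i m' fun i' j hj => ?_)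
  split_ifs at hj with hi'
  · subst hi'
    exact hbelow j (by omega)
  · exact hlow i' j (hj.trans_le (hm'' i' hi'))

/-! ### The linear equation of the wave function -/

theorem coeff_wave_two_waveOrd_add {τ : Site → TimeSeries} (hτ : ∀ m, τ m ≠ 0) (m : Site) :
    (wave τ (m + (1, 1)) 2).coeff (waveOrd 2 m) +
      rho τ m * (wave τ m 2).coeff (waveOrd 2 m) = 0 := by
  have hord : waveOrd 2 m = waveOrd 2 (m + (1, 1)) := by simp [waveOrd]
  rw [coeff_wave_waveOrd, hord, coeff_wave_waveOrd, rho]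
  have h₁ := tauQ_ne_zero (hτ m)
  have h₂ := tauQ_ne_zero (hτ (m + (1, 0)))
  have h₃ := tauQ_ne_zero (hτ (m + (1, 1)))
  simp only [waveSign, waveShift, Matrix.cons_val, Prod.snd_add]
  rw [zpow_add₀ (neg_ne_zero.2 one_ne_zero)]
  field_simp
  ring

theorem wave_linear {τ : Site → TimeSeries} (hτ : ∀ m, τ m ≠ 0) (hKP : IsThreeKPTau τ)
    (m : Site) : wave τ (m + (1, 1)) - wave τ (m + (1, 0)) + rho τ m • wave τ m = 0 := by
  refine eq_zero_of_mem_bilinear hτ (add_mem (sub_mem (wave_mem_bilinear hKP _)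
    (wave_mem_bilinear hKP _)) (Submodule.smul_mem _ _ (wave_mem_bilinear hKP _)))
    (m + (1, 0)) fun i n hn => ?_
  simp only [Pi.add_apply, Pi.sub_apply, Pi.smul_apply, HahnSeries.coeff_add,
    HahnSeries.coeff_sub, HahnSeries.coeff_smul, smul_eq_mul]
  have hzero (m' : Site) (h : n < waveOrd i m') : (wave τ m' i).coeff n = 0 :=
    coeff_wave_of_lt τ h
  obtain rfl | rfl | rfl : i = 0 ∨ i = 1 ∨ i = 2 := by omega
  · have h₁ : waveOrd 0 (m + (1, 1)) = waveOrd 0 (m + (1, 0)) := by simp [waveOrd]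
    have h₂ : waveOrd 0 m = waveOrd 0 (m + (1, 0)) + 1 := by simp [waveOrd]
    rw [hzero m (hn.trans_eq h₂.symm), mul_zero, add_zero]
    rcases (Int.lt_add_one_iff.1 hn).lt_or_eq with h | rfl
    · rw [hzero _ (h.trans_eq h₁.symm), hzero _ h, sub_zero]
    · rw [coeff_wave_zero_waveOrd hτ, ← h₁, coeff_wave_zero_waveOrd hτ, sub_self]
  · have h : n < waveOrd 1 m := by simpa [waveOrd] using hn
    have h₁ : waveOrd 1 (m + (1, 1)) = waveOrd 1 m + 1 := by simp [waveOrd]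
    have h₂ : waveOrd 1 (m + (1, 0)) = waveOrd 1 m := by simp [waveOrd]
    rw [hzero _ (by omega), hzero _ (by omega), hzero _ h, mul_zero, sub_zero, add_zero]
  · have h₁ : waveOrd 2 (m + (1, 1)) = waveOrd 2 m := by simp [waveOrd]
    have h₂ : waveOrd 2 (m + (1, 0)) = waveOrd 2 m + 1 := by simp [waveOrd]; ring
    rw [if_neg (by decide), add_zero, h₂, Int.lt_add_one_iff] at hn
    rw [hzero _ (Int.lt_add_one_iff.2 hn |>.trans_eq h₂.symm), sub_zero]
    rcases hn.lt_or_eq with h | rfl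
    · rw [hzero _ (h.trans_eq h₁.symm), hzero _ h, mul_zero, add_zero]
    · exact coeff_wave_two_waveOrd_add hτ m

/-! ### Wave operators -/

section WaveOperator

open OpRing

variable {τ : Site → TimeSeries} {v : Site} [IsUnitStep v] {i : Fin 3}

/-- The wave operator of component `i`: its coefficients are those of the wave function, with the
powers of the spectral parameter relative to the leading one replaced by powers of `Λ ^ v`. -/
def waveOp (v : Site) [IsUnitStep v] (τ : Site → TimeSeries) (i : Fin 3) : OpRing v :=
  ser v fun n m => (wave τ m i).coeff (n + waveOrd i m)

theorem waveOp_mem_within : (waveOp v τ i : Op) ∈ within v 0 0 := series_mem_within _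

theorem waveOp_apply (j m : Site) : (waveOp v τ i : Op) j m =
    if across v j = 0 then (wave τ m i).coeff (along v j + waveOrd i m) else 0 := by
  split_ifs with hj
  · rcases lt_or_ge (along v j) 0 with h | h
    · rw [eq_zero_of_mem_within (v := v) waveOp_mem_within h, coeff_wave_of_lt τ (by omega)]
    · obtain ⟨n, hn⟩ := Int.eq_ofNat_of_zero_le h
      rw [eq_along_smul_of_across_eq_zero v hj, map_zsmul, along_self, smul_eq_mul, mul_one, hn,
        natCast_zsmul, waveOp, coe_ser, series_apply_nsmul]
  · by_contra h
    exact hj (across_eq_zero_of_mem_within (v := v) waveOp_mem_within h)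

theorem waveOp_apply_zsmul (n : ℤ) (m : Site) :
    (waveOp v τ i : Op) (n • v) m = (wave τ m i).coeff (n + waveOrd i m) := by
  rw [waveOp_apply, map_zsmul, map_zsmul, across_self, along_self, smul_zero, if_pos rfl,
    smul_eq_mul, mul_one]

theorem waveOp_apply_zero_ne_zero (hτ : ∀ m, τ m ≠ 0) (m : Site) :
    (waveOp v τ i : Op) ((0 : ℤ) • v) m ≠ 0 := by
  rw [waveOp_apply_zsmul, zero_add, coeff_wave_waveOrd]
  exact div_ne_zero (mul_ne_zero (waveSign_ne_zero m i) (tauQ_ne_zero (hτ _))) (tauQ_ne_zero (hτ m))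

theorem sh_mul_waveOp_mul_sh_apply {u w : Site} (h : u + w = waveOrd i u • v) (j m : Site) :
    ((sh v u * waveOp v τ i * sh v w : OpRing v) : Op) j m =
      if across v j = 0 then (wave τ (m + u) i).coeff (along v j + waveOrd i m) else 0 := by
  rw [coe_mul, coe_mul, coe_sh, coe_sh, mul_shift_apply, shift_mul_apply, sub_sub, add_comm w, h,
    waveOp_apply]
  simp only [map_sub, map_add, map_zsmul, across_self, along_self, smul_eq_mul, mul_zero,
    sub_zero, mul_one]
  rw [sub_add_add_cancel]

/-- The operator `H` annihilates the wave function; the shifts `u₁`, `u₀` account for the leading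
powers of the spectral parameter. -/
theorem waveOp_linear (hτ : ∀ m, τ m ≠ 0) (hKP : IsThreeKPTau τ) {u₁ u₀ : Site}
    (h₁ : (1, 1) + u₁ = waveOrd i (1, 1) • v) (h₀ : (1, 0) + u₀ = waveOrd i (1, 0) • v) :
    sh v (1, 1) * waveOp v τ i * sh v u₁ - sh v (1, 0) * waveOp v τ i * sh v u₀ +
      ofFn v (rho τ) * waveOp v τ i = 0 := Subtype.ext (by
  ext j m
  rw [AddSubgroup.coe_add, AddSubgroup.coe_sub, Op.add_apply, Op.sub_apply,
    sh_mul_waveOp_mul_sh_apply h₁, sh_mul_waveOp_mul_sh_apply h₀, coe_mul, coe_ofFn, fn_mul_apply,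
    waveOp_apply]
  change _ = (0 : TimeField)
  split_ifs
  · simpa using congrArg (fun W => (W i).coeff (along v j + waveOrd i m)) (wave_linear hτ hKP m)
  · simp)

/-- The wave operator as a unit. -/
def waveUnit (v : Site) [IsUnitStep v] (hτ : ∀ m, τ m ≠ 0) (i : Fin 3) : (OpRing v)ˣ :=
  leadingUnit 0 (waveOp v τ i) waveOp_mem_within (waveOp_apply_zero_ne_zero hτ)

@[simp] theorem coe_waveUnit (hτ : ∀ m, τ m ≠ 0) :
    (waveUnit v hτ i : OpRing v) = waveOp v τ i := rfl

/-- The Lax operator of component `i`. -/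
def lax (v : Site) [IsUnitStep v] (hτ : ∀ m, τ m ≠ 0) (i : Fin 3) : OpRing v :=
  waveUnit v hτ i * sh v (-v) * ↑(waveUnit v hτ i)⁻¹

theorem lax_pow (hτ : ∀ m, τ m ≠ 0) (k : ℕ) : lax v hτ i ^ k =
    waveUnit v hτ i * shUnit v (-(k • v)) * ↑(waveUnit v hτ i)⁻¹ := by
  rw [lax, Units.conj_pow, coe_shUnit, ← smul_neg, sh_nsmul]

theorem lax_pow_mem_within (hτ : ∀ m, τ m ≠ 0) (k : ℕ) :
    ((lax v hτ i ^ k : OpRing v) : Op) ∈ within v (-k) 0 := by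
  rw [lax_pow]
  have hS := mul_mem_within (waveOp_mem_within (τ := τ) (i := i))
    (shift_mem_within v (-(k • v)))
  refine within_mono ?_ ?_ (mul_mem_within hS (coe_inv_leadingUnit_mem_within 0 _ _ _))
  · rw [map_neg, map_nsmul, along_self, nsmul_one, zero_add, neg_zero, add_zero]
  · rw [map_neg, map_nsmul, across_self, smul_zero, neg_zero, abs_zero, add_zero, add_zero]

end WaveOperator

namespace OpRing

variable {v : Site} [IsUnitStep v]

theorem sub_part_mem_within {P : ℤ → Prop} [DecidablePred P] {a c : ℤ} {A : OpRing v}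
    (hA : (A : Op) ∈ within v a 0) (hP : ∀ j, ¬ P j → c ≤ j) :
    ((A - part P A : OpRing v) : Op) ∈ within v c 0 := fun j m h => by
  rw [AddSubgroup.coe_sub, Op.sub_apply, coe_part, partAlong] at h
  split_ifs at h with hj
  · exact (h (sub_self _)).elim
  · rw [sub_zero] at h
    exact ⟨hP _ hj, (hA j m h).2⟩

theorem part_eq_negSum {N : ℕ} {A : OpRing v} (hA : (A : Op) ∈ within v (-N) 0) {P : ℤ → Prop}
    [DecidablePred P] (hP : ∀ j, P j → j ≤ 0) :
    part P A = negSum v N fun n => if P (-n) then negCoeff A n else 0 := by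
  have hrest : part P (A - negSum v N (negCoeff A)) = 0 :=
    part_eq_zero_of_mem_within (sub_negSum_mem_within hA) fun j hj h => by
      have := hP j h
      omega
  rw [map_sub, sub_eq_zero] at hrest
  rw [hrest, negSum, negSum, map_sum]
  refine Finset.sum_congr rfl fun n _ => ?_
  rw [part_ofFn_mul, part_sh, map_neg, map_nsmul, along_self, nsmul_one]
  split_ifs
  · rfl
  · rw [mul_zero, map_zero, zero_mul]

theorem negSum_mul_apply_zsmul (N : ℕ) (b : ℕ → Site → TimeField) (A : OpRing v) (n : ℤ)
    (m : Site) : ((negSum v N b * A : OpRing v) : Op) (n • v) m =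
      ∑ l ∈ Finset.range (N + 1), b l m * (A : Op) ((n + l) • v) (m - l • v) := by
  rw [negSum, Finset.sum_mul, coe_sum_apply]
  refine Finset.sum_congr rfl fun l _ => ?_
  rw [mul_assoc, coe_mul, coe_mul, coe_ofFn, coe_sh, fn_mul_apply, shift_mul_apply,
    sub_neg_eq_add, ← sub_eq_add_neg, add_smul, natCast_zsmul]

theorem negSum_sub (N : ℕ) (b c : ℕ → Site → TimeField) :
    negSum v N (b - c) = negSum v N b - negSum v N c := by
  simp only [negSum, Pi.sub_apply, map_sub, sub_mul, Finset.sum_sub_distrib]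

theorem negSum_single_zero (N : ℕ) (f : Site → TimeField) :
    negSum v N (Pi.single 0 f) = ofFn v f := by
  rw [negSum, Finset.sum_eq_single_of_mem 0 (Finset.mem_range.2 N.succ_pos) fun n _ hn => by
    rw [Pi.single_eq_of_ne hn, map_zero, zero_mul], Pi.single_eq_same, zero_smul, neg_zero,
    sh_zero, mul_one]

theorem deltaPart_eq_negSum {N : ℕ} {A : OpRing v} (hA : (A : Op) ∈ within v (-N) 0) :
    deltaPart A = negSum v N
      (negCoeff A - Pi.single 0 (∑ n ∈ Finset.range (N + 1), negCoeff A n)) := by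
  rw [deltaPart_eq_negSum_sub hA, negSum_sub, negSum_single_zero]

end OpRing

/-! ### Evolution of the wave operators -/

section Evolution

open OpRing

variable {τ : Site → TimeSeries} {v : Site} {N : ℕ} {b : ℕ → Site → TimeField}

/-- What the wave function, with its exponential factor, lacks to satisfy the evolution equation
`∂_p Ψ = ∑ b_n Λ ^ (-n v) Ψ`. -/
def evolutionDefect (v : Site) (N : ℕ) (b : ℕ → Site → TimeField) (τ : Site → TimeSeries)
    (p : Time) (m : Site) : Fin 3 → LaurentSeries TimeField :=
  (fun i => waveDeriv p i (wave τ m i)) - ∑ l ∈ Finset.range (N + 1), b l m • wave τ (m - l • v)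

theorem evolutionDefect_mem_bilinear (hKP : IsThreeKPTau τ) (p : Time) (m : Site) :
    evolutionDefect v N b τ p m ∈ bilinear τ :=
  sub_mem (waveDeriv_wave_mem_bilinear hKP p m)
    (sum_mem fun _ _ => Submodule.smul_mem _ _ (wave_mem_bilinear hKP _))

theorem coeff_evolutionDefect (p : Time) (m : Site) (i : Fin 3) (n : ℤ) :
    (evolutionDefect v N b τ p m i).coeff n = (waveDeriv p i (wave τ m i)).coeff n -
      ∑ l ∈ Finset.range (N + 1), b l m * (wave τ (m - l • v) i).coeff n := by
  rw [evolutionDefect, Pi.sub_apply, HahnSeries.coeff_sub, Finset.sum_apply, HahnSeries.coeff_sum]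
  rfl

theorem coeff_evolutionDefect_eq_zero (hτ : ∀ m, τ m ≠ 0) {p : Time} {m : Site} {i : Fin 3}
    (hi : i ≠ p.1) (hv : waveOrd i v ≤ 0)
    (hb : i = 0 → ∑ l ∈ Finset.range (N + 1),
      b l m * (wave τ (m - l • v) 0).coeff (waveOrd 0 m) = 0)
    {n : ℤ} (hn : n < waveOrd i m + if i = 0 then 1 else 0) :
    (evolutionDefect v N b τ p m i).coeff n = 0 := by
  rw [coeff_evolutionDefect, coeff_waveDeriv, if_neg hi, add_zero, ← timeDerivation_apply]
  rcases lt_or_ge n (waveOrd i m) with h | h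
  · rw [coeff_wave_of_lt τ h, map_zero, zero_sub, neg_eq_zero]
    refine Finset.sum_eq_zero fun l _ => ?_
    rw [coeff_wave_of_lt τ, mul_zero]
    rw [map_sub, map_nsmul]
    exact h.trans_le (le_sub_self_iff _ |>.2 (nsmul_nonpos hv l))
  · split_ifs at hn with h0
    · obtain rfl : n = waveOrd i m := by omega
      subst h0
      rw [coeff_wave_zero_waveOrd hτ, hb rfl, Derivation.map_one_eq_zero, sub_zero]
    · omega

variable [IsUnitStep v] {i : Fin 3}

theorem deriv_waveOp_mem_within (hτ : ∀ m, τ m ≠ 0) (p : Time) :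
    (deriv p (waveOp v τ i) : Op) ∈ within v (if i = 0 then 1 else 0) 0 := fun j m h => by
  obtain ⟨hj, hj'⟩ := tderiv_mem_within p waveOp_mem_within j m h
  refine ⟨?_, hj'⟩
  split_ifs with hi
  · by_contra! hlt
    obtain rfl : j = (0 : ℤ) • v := by
      rw [eq_along_smul_of_across_eq_zero v (abs_nonpos_iff.1 hj')]
      congr 1
      omega
    refine h ?_
    rw [coe_deriv, tderiv, waveOp_apply_zsmul, zero_add, hi, coeff_wave_zero_waveOrd hτ,
      ← timeDerivation_apply, Derivation.map_one_eq_zero]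
  · exact hj

theorem coeff_evolutionDefect_add_waveOrd (hv : waveOrd i v = 1) (k : ℕ+) (n : ℤ) (m : Site) :
    ((deriv (i, k) (waveOp v τ i) + waveOp v τ i * sh v (-((k : ℕ) • v)) -
      negSum v N b * waveOp v τ i : OpRing v) : Op) (n • v) m =
      (evolutionDefect v N b τ (i, k) m i).coeff (n + waveOrd i m) := by
  rw [coeff_evolutionDefect, coeff_waveDeriv, if_pos rfl, AddSubgroup.coe_sub, Op.sub_apply,
    AddSubgroup.coe_add, Op.add_apply, coe_deriv, tderiv, waveOp_apply_zsmul, coe_mul, coe_sh,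
    mul_shift_apply, sub_neg_eq_add, ← natCast_zsmul v k, ← add_smul, waveOp_apply_zsmul,
    negSum_mul_apply_zsmul, add_right_comm n]
  congr 1
  refine Finset.sum_congr rfl fun l _ => ?_
  rw [waveOp_apply_zsmul, map_sub, map_nsmul, hv, nsmul_one]
  congr 2
  ring

/-- The Lax operator makes the defect of high order on component `i`, and the bilinear equation
leaves no room for such a defect. -/
theorem deriv_waveOp (hτ : ∀ m, τ m ≠ 0) (hKP : IsThreeKPTau τ) (hv : waveOrd i v = 1)
    (hv' : ∀ i', i' ≠ i → waveOrd i' v ≤ 0) (k : ℕ+)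
    (hlax : ((lax v hτ i ^ (k : ℕ) - negSum v N b : OpRing v) : Op) ∈
      within v (if i = 0 then 1 else 0) 0)
    (hb : i ≠ 0 → ∀ m, ∑ l ∈ Finset.range (N + 1),
      b l m * (wave τ (m - l • v) 0).coeff (waveOrd 0 m) = 0) :
    deriv (i, k) (waveOp v τ i) =
      negSum v N b * waveOp v τ i - waveOp v τ i * sh v (-((k : ℕ) • v)) := by
  set U := deriv (i, k) (waveOp v τ i) + waveOp v τ i * sh v (-((k : ℕ) • v)) -
    negSum v N b * waveOp v τ i with hU
  have hSE : waveOp v τ i * sh v (-((k : ℕ) • v)) = lax v hτ i ^ (k : ℕ) * waveOp v τ i := by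
    rw [lax_pow, ← coe_waveUnit hτ, Units.inv_mul_cancel_right, coe_shUnit]
  have hUmem : (U : Op) ∈ within v (if i = 0 then 1 else 0) 0 := by
    rw [hU, hSE, add_sub_assoc, ← sub_mul]
    refine add_mem (deriv_waveOp_mem_within hτ _) ?_
    simpa using mul_mem_within hlax (waveOp_mem_within (τ := τ) (i := i))
  have hdefect (m : Site) : evolutionDefect v N b τ (i, k) m = 0 := by
    refine eq_zero_of_mem_bilinear hτ (evolutionDefect_mem_bilinear hKP _ m) m fun i' n hn => ?_
    obtain rfl | hi := eq_or_ne i' i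
    · rw [← sub_add_cancel n (waveOrd i' m), ← coeff_evolutionDefect_add_waveOrd hv]
      refine eq_zero_of_mem_within hUmem ?_ m
      rw [map_zsmul, along_self, smul_eq_mul, mul_one]
      omega
    · exact coeff_evolutionDefect_eq_zero hτ hi (hv' i' hi) (fun h => hb (h ▸ hi.symm) m) hn
  rw [eq_sub_iff_add_eq, ← sub_eq_zero]
  refine Subtype.ext (funext₂ fun j m => ?_)
  by_contra hj
  refine hj ?_
  rw [eq_along_smul_of_across_eq_zero v (across_eq_zero_of_mem_within hUmem hj),
    coeff_evolutionDefect_add_waveOrd hv, hdefect]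
  rfl

theorem deriv_waveOp_zero (hτ : ∀ m, τ m ≠ 0) (hKP : IsThreeKPTau τ) (hv : waveOrd 0 v = 1)
    (hv' : ∀ i, i ≠ 0 → waveOrd i v ≤ 0) (k : ℕ+) : deriv (0, k) (waveOp v τ 0) =
      part (· ≤ 0) (lax v hτ 0 ^ (k : ℕ)) * waveOp v τ 0 -
        waveOp v τ 0 * sh v (-((k : ℕ) • v)) := by
  have hL := lax_pow_mem_within (v := v) (i := 0) hτ k
  have hB := part_eq_negSum hL (P := (· ≤ 0)) fun _ => id
  rw [hB]
  refine deriv_waveOp hτ hKP hv hv' k ?_ fun h => (h rfl).elim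
  rw [← hB]
  exact sub_part_mem_within hL fun j hj => not_le.1 hj

theorem deriv_waveOp_of_waveOrd_zero_neg (hτ : ∀ m, τ m ≠ 0) (hKP : IsThreeKPTau τ)
    (hv : waveOrd i v = 1) (hv' : ∀ i', i' ≠ i → waveOrd i' v ≤ 0) (hv₀ : waveOrd 0 v < 0)
    (k : ℕ+) : deriv (i, k) (waveOp v τ i) =
      part (· < 0) (lax v hτ i ^ (k : ℕ)) * waveOp v τ i -
        waveOp v τ i * sh v (-((k : ℕ) • v)) := by
  have hi : i ≠ 0 := fun h => by
    subst h
    omega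
  have hL := lax_pow_mem_within (v := v) (i := i) hτ k
  have hB := part_eq_negSum hL (P := (· < 0)) fun _ => le_of_lt
  rw [hB]
  refine deriv_waveOp hτ hKP hv hv' k ?_ fun _ m => Finset.sum_eq_zero fun l _ => ?_
  · rw [← hB, if_neg hi]
    exact sub_part_mem_within hL fun j hj => not_lt.1 hj
  · rcases l.eq_zero_or_pos with rfl | hl
    · simp
    · rw [coeff_wave_of_lt τ, mul_zero]
      rw [map_sub, map_nsmul]
      have hneg : l • waveOrd 0 v < 0 := nsmul_neg hv₀ hl.ne'
      omega

/-- On component `0` the wave function has constant leading coefficient, which the operators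
without term of order zero in `Λ ^ (-v) - 1` annihilate. -/
theorem deriv_waveOp_of_waveOrd_zero_eq_zero (hτ : ∀ m, τ m ≠ 0) (hKP : IsThreeKPTau τ)
    (hv : waveOrd i v = 1) (hv' : ∀ i', i' ≠ i → waveOrd i' v ≤ 0) (hv₀ : waveOrd 0 v = 0)
    (k : ℕ+) : deriv (i, k) (waveOp v τ i) =
      deltaPart (lax v hτ i ^ (k : ℕ)) * waveOp v τ i -
        waveOp v τ i * sh v (-((k : ℕ) • v)) := by
  have hi : i ≠ 0 := fun h => by
    subst h
    omega
  have hL := lax_pow_mem_within (v := v) (i := i) hτ k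
  have hB := deltaPart_eq_negSum hL
  rw [hB]
  refine deriv_waveOp hτ hKP hv hv' k ?_ fun _ m => ?_
  · rw [← hB, if_neg hi]
    exact sub_deltaPart_mem_within hL
  · have hone (l : ℕ) : (wave τ (m - l • v) 0).coeff (waveOrd 0 m) = 1 := by
      have h := coeff_wave_zero_waveOrd hτ (m - l • v)
      rwa [map_sub, map_nsmul, hv₀, smul_zero, sub_zero] at h
    simp only [hone, mul_one]
    rw [← Finset.sum_apply]
    simp only [Pi.sub_apply, Finset.sum_sub_distrib, Finset.sum_pi_single', Finset.mem_range,
      Nat.succ_pos, if_true, sub_self]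

end Evolution

/-! ### Evolution of the operator of the linear equation -/

namespace OpRing

variable {v : Site} [IsUnitStep v]

theorem shUnit_commute (u w : Site) : Commute (shUnit v u) (shUnit v w) :=
  Units.ext (sh_commute u w).eq

theorem part_conj_sub_part_eq {F : (OpRing v)ˣ} {w : Site}
    (hF : F = oneSubSh v * shUnit v w ∨ F = -(oneSubSh v * shUnit v w)) (A : OpRing v) :
    part (· ≤ 0) (F * A * ↑F⁻¹ : OpRing v) -
        part (· = 0) (↑(oneSubSh v)⁻¹ * (F * A * ↑F⁻¹) : OpRing v) =
      F * deltaPart A * ↑F⁻¹ := by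
  have hcomm : oneSubSh v * shUnit v w = shUnit v w * oneSubSh v :=
    Units.ext ((Commute.one_left _).sub_left (sh_commute v w)).eq
  have hconj (B : OpRing v) : (F * B * ↑F⁻¹ : OpRing v) =
      (1 - sh v v) * (sh v w * (B * ↑(oneSubSh v)⁻¹) * sh v (-w)) := by
    have hFinv : (F * B * ↑F⁻¹ : OpRing v) = ↑(oneSubSh v * shUnit v w) * B *
        ↑(oneSubSh v * shUnit v w)⁻¹ := by
      rcases hF with rfl | rfl
      · rfl
      · simp only [Units.val_neg, inv_neg, neg_mul, mul_neg, neg_neg]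
    rw [hFinv, hcomm, mul_inv_rev, ← hcomm, Units.val_mul, Units.val_mul, coe_inv_shUnit,
      coe_shUnit, coe_oneSubSh]
    simp only [mul_assoc]
  rw [hconj, ← coe_oneSubSh, Units.inv_mul_cancel_left, coe_oneSubSh, part_nonpos_one_sub_sh_mul,
    part_sh_conj, hconj, deltaPart_eq, ← coe_oneSubSh, Units.mul_inv_cancel_right]

end OpRing

section OperatorEvolution

open OpRing

variable {τ : Site → TimeSeries} {v : Site} [IsUnitStep v] {i : Fin 3}

/-- The operator `H`, as an element of the ring of operators along `v`. -/
def opH (v : Site) [IsUnitStep v] (τ : Site → TimeSeries) : OpRing v :=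
  sh v (1, 0) * (sh v (0, 1) - 1) + ofFn v (rho τ)

theorem coe_opH : (opH v τ : Op) = H τ := rfl

theorem opH_eq : opH v τ = sh v (1, 1) - (sh v (1, 0) - ofFn v (rho τ)) := by
  rw [opH, mul_sub, sh_mul_sh, mul_one, Prod.mk_add_mk, add_zero, zero_add, sub_add]

theorem deriv_opH_of_part (hτ : ∀ m, τ m ≠ 0) (hKP : IsThreeKPTau τ)
    {u : Site} (hu : (1, 1) + u = waveOrd i (1, 1) • v) (hv : (1, 0) = waveOrd i (1, 0) • v)
    {T : (OpRing v)ˣ} (hT : (T : OpRing v) = sh v (1, 0) - ofFn v (rho τ)) {k : ℕ+} {P : ℤ → Prop}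
    [DecidablePred P] (hS : deriv (i, k) (waveOp v τ i) =
      part P (lax v hτ i ^ (k : ℕ)) * waveOp v τ i - waveOp v τ i * sh v (-((k : ℕ) • v))) :
    deriv (i, k) (opH v τ) = part P (T * lax v hτ i ^ (k : ℕ) * ↑T⁻¹ : OpRing v) * opH v τ -
      opH v τ * part P (lax v hτ i ^ (k : ℕ)) := by
  have hTS : (shUnit v (1, 1) * waveUnit v hτ i * shUnit v u : OpRing v) = T * waveUnit v hτ i := by
    have h := waveOp_linear hτ hKP hu ((add_zero _).trans hv)
    rw [sh_zero, mul_one, sub_add, sub_eq_zero, ← sub_mul, ← hT] at h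
    exact h
  have hEY := shUnit_commute (v := v) (-((k : ℕ) • v)) u
  rw [opH_eq, ← hT, lax_pow, conj_eq_conj_of_intertwining hTS hEY, ← lax_pow, coe_shUnit,
    coe_inv_shUnit, part_sh_conj]
  exact deriv_sub_eq_of_intertwining (F := shUnit v (1, 1)) (deriv_mul _) hTS hEY hS (deriv_sh _ _)
    (deriv_sh _ _)

theorem rho_ne_zero (hτ : ∀ m, τ m ≠ 0) (m : Site) : rho τ m ≠ 0 :=
  mul_ne_zero (div_ne_zero (tauQ_ne_zero (hτ _)) (tauQ_ne_zero (hτ _)))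
    (div_ne_zero (tauQ_ne_zero (hτ _)) (tauQ_ne_zero (hτ _)))

/-- Multiplication by `ρ`, as a unit. -/
def rhoUnit (v : Site) [IsUnitStep v] (hτ : ∀ m, τ m ≠ 0) : (OpRing v)ˣ where
  val := ofFn v (rho τ)
  inv := ofFn v (rho τ)⁻¹
  val_inv := by
    rw [← map_mul, ← map_one (ofFn v)]
    exact congrArg _ (funext fun m => mul_inv_cancel₀ (rho_ne_zero hτ m))
  inv_val := by
    rw [← map_mul, ← map_one (ofFn v)]
    exact congrArg _ (funext fun m => inv_mul_cancel₀ (rho_ne_zero hτ m))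

theorem deriv_opH_of_deltaPart (hτ : ∀ m, τ m ≠ 0) (hKP : IsThreeKPTau τ) {u w : Site}
    (h₁ : (1, 1) + u = waveOrd i (1, 1) • v) (h₀ : (1, 0) + u = waveOrd i (1, 0) • v)
    {F : (OpRing v)ˣ} (hF : (F : OpRing v) = sh v (1, 0) - sh v (1, 1))
    (hFw : F = oneSubSh v * shUnit v w ∨ F = -(oneSubSh v * shUnit v w)) {k : ℕ+}
    (hS : deriv (i, k) (waveOp v τ i) = deltaPart (lax v hτ i ^ (k : ℕ)) * waveOp v τ i -
      waveOp v τ i * sh v (-((k : ℕ) • v))) :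
    deriv (i, k) (opH v τ) =
      (part (· ≤ 0) (rhoUnit v hτ * lax v hτ i ^ (k : ℕ) * ↑(rhoUnit v hτ)⁻¹ : OpRing v) -
        part (· = 0) (↑(oneSubSh v)⁻¹ *
          (rhoUnit v hτ * lax v hτ i ^ (k : ℕ) * ↑(rhoUnit v hτ)⁻¹) : OpRing v)) * opH v τ -
      opH v τ * deltaPart (lax v hτ i ^ (k : ℕ)) := by
  have hTS : (F * waveUnit v hτ i * shUnit v u : OpRing v) =
      rhoUnit v hτ * waveUnit v hτ i := by
    rw [hF, sub_mul, sub_mul, ← neg_sub]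
    exact (eq_neg_of_add_eq_zero_right (waveOp_linear hτ hKP h₁ h₀)).symm
  have hEY := shUnit_commute (v := v) (-((k : ℕ) • v)) u
  have hDF : deriv (i, k) (F : OpRing v) = 0 := by
    rw [hF, map_sub, deriv_sh, deriv_sh, sub_zero]
  have hX : opH v τ = -(F - rhoUnit v hτ) := by
    rw [opH_eq, hF]
    change _ = -(_ - ofFn v (rho τ))
    abel
  have h := deriv_sub_eq_of_intertwining (deriv_mul _) hTS hEY hS hDF (deriv_sh _ _)
  rw [lax_pow, conj_eq_conj_of_intertwining hTS hEY, ← lax_pow, part_conj_sub_part_eq hFw, hX,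
    map_neg, h, mul_neg, neg_mul, neg_sub_neg, neg_sub]

end OperatorEvolution

/-! ### The four evolution equations -/

section Equations

open OpRing

variable {τ : Site → TimeSeries} {v : Site} [IsUnitStep v]

theorem part₁_coe (hv : v.2 = 0) {P Q : ℤ → Prop} [DecidablePred P]
    [DecidablePred Q] (hPQ : ∀ n, P n ↔ Q (v.1 * n)) (A : OpRing v) :
    part₁ P (A : Op) = (part Q A : OpRing v) := by
  ext j m
  simp only [part₁, coe_part, partAlong, along_apply, hv, zero_mul, add_zero, hPQ]

theorem part₂_coe (hv : v.1 = 0) {P Q : ℤ → Prop} [DecidablePred P]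
    [DecidablePred Q] (hPQ : ∀ n, P n ↔ Q (v.2 * n)) (A : OpRing v) :
    part₂ P (A : Op) = (part Q A : OpRing v) := by
  ext j m
  simp only [part₂, coe_part, partAlong, along_apply, hv, zero_mul, zero_add, hPQ]

theorem coe_waveOp (i : Fin 3) : (waveOp v τ i : Op) =
    series v fun n m =>
      waveSign m i * tauQ (shiftCoeff i (-1) (τ (m + waveShift i)) n) / tauQ (τ m) := by
  simp only [waveOp, coe_ser, coeff_wave]

theorem S₁_eq_waveOp : S₁ τ = waveOp (-1, 0) τ 0 := by
  simp [S₁, coe_waveOp, waveSign, waveShift]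

theorem S₂_eq_waveOp : S₂ τ = waveOp (0, 1) τ 1 := by
  simp [S₂, coe_waveOp, waveSign, waveShift]

theorem S₃_eq_waveOp : S₃ τ = waveOp (1, 0) τ 2 := (coe_waveOp 2).symm

theorem S₃'_eq_waveOp : S₃' τ = waveOp (0, -1) τ 2 := (coe_waveOp 2).symm

theorem L₁_pow (hτ : ∀ m, τ m ≠ 0) (k : ℕ) :
    L₁ τ ^ k = (lax (-1, 0) hτ 0 ^ k : OpRing (-1, 0)) := by
  rw [coe_pow, L₁, S₁_eq_waveOp]
  rfl

theorem L₂_pow (hτ : ∀ m, τ m ≠ 0) (k : ℕ) :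
    L₂ τ ^ k = (lax (0, 1) hτ 1 ^ k : OpRing (0, 1)) := by
  rw [coe_pow, L₂, S₂_eq_waveOp]
  rfl

theorem L₃_pow (hτ : ∀ m, τ m ≠ 0) (k : ℕ) :
    L₃ τ ^ k = (lax (1, 0) hτ 2 ^ k : OpRing (1, 0)) := by
  rw [coe_pow, L₃, S₃_eq_waveOp]
  rfl

theorem L₃'_pow (hτ : ∀ m, τ m ≠ 0) (k : ℕ) :
    L₃' τ ^ k = (lax (0, -1) hτ 2 ^ k : OpRing (0, -1)) := by
  rw [coe_pow, L₃', S₃'_eq_waveOp]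
  rfl

theorem tderiv_zero_H (hτ : ∀ m, τ m ≠ 0) (hKP : IsThreeKPTau τ) (k : ℕ+) :
    tderiv (0, k) (H τ) = C₁ τ k * H τ - H τ * B₁ τ k := by
  have hmem : ((sh (-1, 0) (1, 0) - ofFn _ (rho τ) : OpRing (-1, 0)) : Op) ∈
      within (-1, 0) (-1) 0 :=
    sub_mem (within_mono (by decide) (by decide) (shift_mem_within _ _))
      (within_mono (by decide) le_rfl (fn_mem_within _ _))
  let T := leadingUnit (-1) (sh (-1, 0) (1, 0) - ofFn _ (rho τ)) hmem fun m => by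
    change (shift (1, 0) - fn (rho τ) : Op) _ m ≠ 0
    rw [Op.sub_apply]
    simp [shift, fn]
  have hS := deriv_waveOp_zero (v := (-1, 0)) hτ hKP rfl (by decide) k
  have h := deriv_opH_of_part (u := (0, -1)) (T := T) hτ hKP rfl rfl rfl hS
  have hB (A : OpRing (-1, 0)) : part₁ (0 ≤ ·) (A : Op) = (part (· ≤ 0) A : OpRing (-1, 0)) :=
    part₁_coe rfl (fun n => by simp) A
  rw [B₁, C₁, L₁_pow hτ, hB, ← coe_opH (v := (-1, 0))]
  exact (congrArg Subtype.val h).trans (congrArg (· * _ - _) (hB _).symm)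

theorem tderiv_two_H (hτ : ∀ m, τ m ≠ 0) (hKP : IsThreeKPTau τ) (k : ℕ+) :
    tderiv (2, k) (H τ) = C₃ τ k * H τ - H τ * B₃ τ k := by
  have hmem : ((sh (1, 0) (1, 0) - ofFn _ (rho τ) : OpRing (1, 0)) : Op) ∈ within (1, 0) 0 0 :=
    sub_mem (within_mono (by decide) (by decide) (shift_mem_within _ _))
      (fn_mem_within _ _)
  let T := leadingUnit 0 (sh (1, 0) (1, 0) - ofFn _ (rho τ)) hmem fun m => by
    change (shift (1, 0) - fn (rho τ) : Op) _ m ≠ 0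
    rw [Op.sub_apply]
    have hne : (0 : Site) ≠ (1, 0) := by decide
    simp [shift, fn, hne, rho_ne_zero hτ]
  have hS := deriv_waveOp_of_waveOrd_zero_neg (v := (1, 0)) (i := 2) hτ hKP rfl (by decide)
    (by decide) k
  have h := deriv_opH_of_part (u := (-1, -1)) (T := T) hτ hKP rfl rfl rfl hS
  have hB (A : OpRing (1, 0)) : part₁ (· < 0) (A : Op) = (part (· < 0) A : OpRing (1, 0)) :=
    part₁_coe rfl (fun n => by simp) A
  rw [B₃, C₃, L₃_pow hτ, hB, ← coe_opH (v := (1, 0))]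
  exact (congrArg Subtype.val h).trans (congrArg (· * _ - _) (hB _).symm)

theorem tderiv_one_H (hτ : ∀ m, τ m ≠ 0) (hKP : IsThreeKPTau τ) (k : ℕ+) :
    tderiv (1, k) (H τ) = C₂ τ k * H τ - H τ * B₂ τ k := by
  have hF : ((oneSubSh (0, 1) * shUnit (0, 1) (1, 0) : (OpRing (0, 1))ˣ) : OpRing (0, 1)) =
      sh _ (1, 0) - sh _ (1, 1) := by
    rw [Units.val_mul, coe_oneSubSh, coe_shUnit, sub_mul, one_mul, sh_mul_sh]
    rfl
  have hS := deriv_waveOp_of_waveOrd_zero_eq_zero (v := (0, 1)) (i := 1) hτ hKP rfl (by decide)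
    rfl k
  have h := deriv_opH_of_deltaPart (u := (-1, 0)) hτ hKP rfl rfl hF (.inl rfl) hS
  have hle (A : OpRing (0, 1)) : part₂ (· ≤ 0) (A : Op) = (part (· ≤ 0) A : OpRing (0, 1)) :=
    part₂_coe rfl (fun n => by simp) A
  have hzero (A : OpRing (0, 1)) : part₂ (· = 0) (A : Op) = (part (· = 0) A : OpRing (0, 1)) :=
    part₂_coe rfl (fun n => by simp) A
  rw [B₂, C₂, L₂_pow hτ, Δ₂starPart_eq_deltaPart (lax_pow_mem_within hτ k), ← coe_opH (v := (0, 1))]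
  simp only [← ser_ite_mul_sh_neg, ← mul_assoc] at h
  exact (congrArg Subtype.val h).trans
    (congrArg (· * _ - _) (congrArg₂ (· - ·) (hle _).symm (hzero _).symm))

theorem tderiv_two_H' (hτ : ∀ m, τ m ≠ 0) (hKP : IsThreeKPTau τ) (k : ℕ+) :
    tderiv (2, k) (H τ) = C₃' τ k * H τ - H τ * B₃' τ k := by
  have hF : ((-(oneSubSh (0, -1) * shUnit (0, -1) (1, 1)) : (OpRing (0, -1))ˣ) : OpRing (0, -1)) =
      sh _ (1, 0) - sh _ (1, 1) := by
    rw [Units.val_neg, Units.val_mul, coe_oneSubSh, coe_shUnit, sub_mul, one_mul, sh_mul_sh,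
      neg_sub]
    rfl
  have hS := deriv_waveOp_of_waveOrd_zero_eq_zero (v := (0, -1)) (i := 2) hτ hKP rfl (by decide)
    rfl k
  have h := deriv_opH_of_deltaPart (u := (-1, -1)) hτ hKP rfl rfl hF (.inr rfl) hS
  have hle (A : OpRing (0, -1)) : part₂ (0 ≤ ·) (A : Op) = (part (· ≤ 0) A : OpRing (0, -1)) :=
    part₂_coe rfl (fun n => by simp) A
  have hzero (A : OpRing (0, -1)) : part₂ (· = 0) (A : Op) = (part (· = 0) A : OpRing (0, -1)) :=
    part₂_coe rfl (fun n => by simp) A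
  rw [B₃', C₃', L₃'_pow hτ, Δ₂part_eq_deltaPart (lax_pow_mem_within hτ k), ← coe_opH (v := (0, -1))]
  simp only [← ser_ite_mul_sh_neg, ← mul_assoc] at h
  exact (congrArg Subtype.val h).trans
    (congrArg (· * _ - _) (congrArg₂ (· - ·) (hle _).symm (hzero _).symm))

end Equations

end

end ThreeKP

theorem mainTheorem9 (τ : ℤ × ℤ → ThreeKP.TimeSeries) (hτ : ∀ m, τ m ≠ 0)
    (hKP : ThreeKP.IsThreeKPTau τ) (k : ℕ+) :
    ThreeKP.Op.tderiv (0, k) (ThreeKP.H τ) =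
        ThreeKP.C₁ τ k * ThreeKP.H τ - ThreeKP.H τ * ThreeKP.B₁ τ k ∧
      ThreeKP.Op.tderiv (1, k) (ThreeKP.H τ) =
        ThreeKP.C₂ τ k * ThreeKP.H τ - ThreeKP.H τ * ThreeKP.B₂ τ k ∧
      ThreeKP.Op.tderiv (2, k) (ThreeKP.H τ) =
        ThreeKP.C₃ τ k * ThreeKP.H τ - ThreeKP.H τ * ThreeKP.B₃ τ k ∧
      ThreeKP.Op.tderiv (2, k) (ThreeKP.H τ) =
        ThreeKP.C₃' τ k * ThreeKP.H τ - ThreeKP.H τ * ThreeKP.B₃' τ k :=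
  ⟨ThreeKP.tderiv_zero_H hτ hKP k, ThreeKP.tderiv_one_H hτ hKP k, ThreeKP.tderiv_two_H hτ hKP k,
    ThreeKP.tderiv_two_H' hτ hKP k⟩
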